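/- Let \(n\ge 2\), let \(k\) be a field whose characteristic does not divide \(2n\) (characteristic \(0\) is allowed), and let \(R=k_{-1}[x_1,\dots,x_n]\) be the \(k\)-algebra generated by \(x_1,\dots,x_n\) subject to \(x_ix_j=-x_jx_i\) for all \(i\ne j\), graded by \(\deg x_i=1\). Let \(W\) be the group of graded automorphisms of \(R\) generated by \(\sigma: x_i\mapsto x_{i+1}\ (1\le i\le n-1),\ x_n\mapsto x_1\). Let \(\operatorname{GKdim}\) denote Gelfand–Kirillov dimension. Let \(\mathsf p(R,W)=\operatorname{GKdim}R-\operatorname{GKdim}\bigl((R\# kW)/I\bigr)\), where \(R\# kW\) is the smash product (skew group algebra) and \(I\) is its two-sided ideal generated by \(1\#\frac1{|W|}\sum_{g\in W}g\). For \(g\in W\) let \(\mathsf r(g)\) be \(\operatorname{GKdim}R\) minus the order of the pole at \(t=1\) of \(\operatorname{Tr}(g,t)=\sum_{i\ge0}\operatorname{Tr}(g|_{R_i})t^i\), and let \(\mathsf r(R,W)=\min\{\mathsf r(g)\mid 1\ne g\in W\}\). Let \(\phi\) be Euler's totient function. Then: 1. If \(n=2^d\) for some \(d\), then \(\mathsf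 p(R,W)=n\). 2. If \(n=2^d\) for some \(d\), then \(\mathsf r(R,W)=n\); otherwise \(\mathsf r(R,W)=n\left(1-\frac1p\right)\), where \(p\) is the smallest odd prime factor of \(n\). 3. \(\mathsf p(R,W)\ge\phi(n)\) if \(4\nmid n\), and \(\mathsf p(R,W)\ge\phi(n)/2\) if \(4\mid n\). 4. If \(n=p^d\) with \(p\) prime, then \(\mathsf p(R,W)\ge\mathsf r(R,W)\), and \(\mathsf r(R,W)=n\) if \(p=2\), \(\mathsf r(R,W)=n\left(1-\frac1p\right)\) if \(p>2\). -/

import Mathlib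

universe u v w

noncomputable section

open Polynomial PowerSeries Filter

/-! ### Gelfand-Kirillov dimension -/

/-- The Gelfand-Kirillov dimension of a `k`-algebra `B`: the supremum, over all finitely generated
`k`-submodules `V` of `B`, of `limsup_{m → ∞} log_m (dim V ^ m)`. It is `EReal`-valued, with
`log 0 = -∞`. -/
def gkDim (k : Type u) (B : Type v) [Field k] [Ring B] [Algebra k B] : EReal :=
  ⨆ V : Submodule k B, ⨆ _ : V.FG,
    limsup (fun m : ℕ =>
      ENNReal.log ((Module.finrank k ↥(V ^ m) : ℕ) : ENNReal) / ((Real.log (m : ℝ) : ℝ) : EReal))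
      atTop

/-! ### Pertinency of a finite group action -/

/-- The element `1 # ∫` of the smash product `A # kG`, where `∫ = |G|⁻¹ ∑ g` is the integral of the
group algebra `kG` with `ε(∫) = 1`. The smash product `A # kG` is the skew group algebra, with
elements `∑ a_g # g` and multiplication `(a # g) (b # h) = a (g • b) # g h`. -/
def smashIntegral (k : Type u) (A : Type v) (G : Type w) [Field k] [Ring A] [Algebra k A]
    [Group G] [Finite G] [MulSemiringAction G A] [SMulCommClass G k A] : SkewMonoidAlgebra A G :=
  ∑ᶠ g : G, SkewMonoidAlgebra.single g (algebraMap k A ((Nat.card G : k)⁻¹))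

/-- The pertinency `p(A, G) = GKdim A - GKdim ((A # kG) / I)`, where `I` is the two-sided ideal
generated by `1 # ∫`. -/
def pertinency (k : Type u) (A : Type v) (G : Type w) [Field k] [Ring A] [Algebra k A]
    [Group G] [Finite G] [MulSemiringAction G A] [SMulCommClass G k A] : EReal :=
  gkDim k A - gkDim k (TwoSidedIdeal.span {smashIntegral k A G}).ringCon.Quotient

/-! ### Reflection numbers -/

/-- The group of graded algebra automorphisms of `A = ⨁ 𝒜 i`. -/
def gradedAut {k : Type u} {A : Type v} [Field k] [Ring A] [Algebra k A]
    (𝒜 : ℕ → Submodule k A) : Subgroup (A ≃ₐ[k] A) where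
  carrier := {g | ∀ i, (𝒜 i).map g.toLinearMap = 𝒜 i}
  one_mem' i := Submodule.map_id (𝒜 i)
  mul_mem' {g h} hg hh i := by
    have : (g * h).toLinearMap = g.toLinearMap.comp h.toLinearMap := rfl
    rw [this, Submodule.map_comp, hh i, hg i]
  inv_mem' {g} hg i := by
    conv_lhs => rw [← hg i]
    rw [← Submodule.map_comp]
    have : (g⁻¹).toLinearMap.comp g.toLinearMap = LinearMap.id := by
      ext x
      exact g.symm_apply_apply x
    rw [this, Submodule.map_id]

/-- The trace series `Tr(g, t) = ∑ Tr(g | 𝒜 i) t ^ i` of a graded automorphism `g`. -/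
def traceSeries {k : Type u} {A : Type v} [Field k] [Ring A] [Algebra k A]
    (𝒜 : ℕ → Submodule k A) (g : gradedAut 𝒜) : k⟦X⟧ :=
  PowerSeries.mk fun i =>
    LinearMap.trace k (𝒜 i) ((g : A ≃ₐ[k] A).toLinearMap.restrict
      (p := 𝒜 i) (q := 𝒜 i) fun _ hx => (g.2 i).le (Submodule.mem_map_of_mem hx))

/-- The order of the pole at `t = a` of a power series `F` that is a rational function: the least
`m` such that `(t - a) ^ m * F` is a rational function without pole at `a`.
(It is `⊤` if `F` is not a rational function.) -/
def poleOrder {k : Type u} [Field k] (F : k⟦X⟧) (a : k) : EReal :=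
  ⨅ m ∈ {m : ℕ | ∃ P Q : k[X], Q.eval a ≠ 0 ∧
    (((Polynomial.X - Polynomial.C a) ^ m * Q : k[X]) : k⟦X⟧) * F = (P : k⟦X⟧)}, (m : EReal)

/-- The reflection number `r(g) = GKdim A - (order of the pole of Tr(g, t) at t = 1)`. -/
def autReflectionNumber {k : Type u} {A : Type v} [Field k] [Ring A] [Algebra k A]
    (𝒜 : ℕ → Submodule k A) (g : gradedAut 𝒜) : EReal :=
  gkDim k A - poleOrder (traceSeries 𝒜 g) 1

/-- The reflection number `r(A, G) = min {r(g) | 1 ≠ g ∈ G}` of a finite group `G` of graded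
automorphisms. -/
def reflectionNumber {k : Type u} {A : Type v} [Field k] [Ring A] [Algebra k A]
    (𝒜 : ℕ → Submodule k A) (G : Subgroup (gradedAut 𝒜)) : EReal :=
  ⨅ g ∈ {g : gradedAut 𝒜 | g ∈ G ∧ g ≠ 1}, autReflectionNumber 𝒜 g

/-! ### The `(-1)`-skew polynomial ring -/

/-- The relations `x_i x_j = - x_j x_i` for `i ≠ j`. -/
inductive SkewPoly.Rel (k : Type u) [Field k] (n : ℕ) :
    FreeAlgebra k (Fin n) → FreeAlgebra k (Fin n) → Prop
  | anticomm (i j : Fin n) (h : i ≠ j) :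
      SkewPoly.Rel k n (FreeAlgebra.ι k i * FreeAlgebra.ι k j)
        (-(FreeAlgebra.ι k j * FreeAlgebra.ι k i))

/-- The `(-1)`-skew polynomial ring `k_{-1}[x_1, …, x_n]`. -/
abbrev SkewPoly (k : Type u) [Field k] (n : ℕ) : Type u := RingQuot (SkewPoly.Rel k n)

namespace SkewPoly

variable (k : Type u) [Field k] (n : ℕ)

/-- The generators. -/
def x (i : Fin n) : SkewPoly k n :=
  RingQuot.mkAlgHom k (Rel k n) (FreeAlgebra.ι k i)

variable {k n} in
theorem x_mul_x {i j : Fin n} (h : i ≠ j) : x k n i * x k n j = -(x k n j * x k n i) := by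
  have := RingQuot.mkAlgHom_rel k (Rel.anticomm (k := k) i j h)
  simpa [x] using this

/-- The standard grading: the homogeneous part of degree `i` is spanned by the products of `i`
generators. -/
def grading (i : ℕ) : Submodule k (SkewPoly k n) := (Submodule.span k (Set.range (x k n))) ^ i

/-- The algebra endomorphism `x_i ↦ x_{s i}`. -/
def permHom (s : Equiv.Perm (Fin n)) : SkewPoly k n →ₐ[k] SkewPoly k n :=
  RingQuot.liftAlgHom k ⟨FreeAlgebra.lift k fun i => x k n (s i), by
    rintro _ _ ⟨i, j, h⟩
    simpa using x_mul_x (fun e => h (s.injective e))⟩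

variable {n} in
@[simp]
theorem permHom_x (s : Equiv.Perm (Fin n)) (i : Fin n) :
    permHom k n s (x k n i) = x k n (s i) := by
  simp [permHom, x]

variable {k n} in
theorem algHom_ext {B : Type v} [Ring B] [Algebra k B] {f g : SkewPoly k n →ₐ[k] B}
    (h : ∀ i, f (x k n i) = g (x k n i)) : f = g := by
  apply RingQuot.ringQuot_ext'
  apply FreeAlgebra.hom_ext
  funext i
  exact h i

/-- The algebra automorphism `x_i ↦ x_{s i}`. -/
def permEquiv (s : Equiv.Perm (Fin n)) : SkewPoly k n ≃ₐ[k] SkewPoly k n :=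
  AlgEquiv.ofAlgHom (permHom k n s) (permHom k n s⁻¹)
    (algHom_ext fun i => by simp) (algHom_ext fun i => by simp)

variable {n} in
@[simp]
theorem permEquiv_x (s : Equiv.Perm (Fin n)) (i : Fin n) :
    permEquiv k n s (x k n i) = x k n (s i) := permHom_x k s i

/-- The permutation action of the symmetric group on `k_{-1}[x_1, …, x_n]` by graded algebra
automorphisms. -/
def permAut : Equiv.Perm (Fin n) →* gradedAut (grading k n) where
  toFun s := ⟨permEquiv k n s, fun i => by
    change (Submodule.span k (Set.range (x k n)) ^ i).map (permHom k n s).toLinearMap = _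
    rw [Submodule.map_pow, Submodule.map_span, ← Set.range_comp]
    have : ((permHom k n s).toLinearMap : SkewPoly k n → SkewPoly k n) ∘ x k n
        = x k n ∘ s := by
      funext i
      simp
    rw [this, s.surjective.range_comp]
    rfl⟩
  map_one' := by
    apply Subtype.ext
    apply AlgEquiv.coe_toAlgHom_injective
    exact algHom_ext fun i => by simp
  map_mul' s t := by
    apply Subtype.ext
    apply AlgEquiv.coe_toAlgHom_injective
    exact algHom_ext fun i => by simp

/-- The group `W` of automorphisms generated by `σ : x_1 ↦ x_2 ↦ ⋯ ↦ x_n ↦ x_1`. -/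
def W : Subgroup (gradedAut (grading k n)) :=
  Subgroup.zpowers (permAut k n (finRotate n))

instance : Finite (W k n) := by
  have : W k n = (Subgroup.zpowers (finRotate n)).map (permAut k n) := by
    rw [MonoidHom.map_zpowers]
    rfl
  rw [this]
  exact inferInstanceAs (Finite ((permAut k n) '' (Subgroup.zpowers (finRotate n) : Set _)))

end SkewPoly

end

/-! The pertinency bounds come from the relations that killing the integral forces. In the quotient
`B = (R # kW)/I`, after adjoining a primitive `n`-th root of unity `ω`, the image `g` of `σ`
satisfies `g ^ n = 1` and `∑ g ^ j = 0`. Left multiplication by `g` splits `B` into eigenspaces,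
where weight `s` means `g * b = ω ^ s • b`, and the weight-zero space vanishes
(`CyclicSkew.eq_zero_of_mul_eq`).

Let `y_a` and `z_c` be the Fourier transforms of the families `x i` and `x i ^ 2`. They lower
weights by `a` and `c`, the `z_c` commute with one another, and `y_a y_b + y_b y_a = 2 z_(a+b)`. If
`c` is prime to `n`, repeated use of `z_c` reaches weight zero from any weight, so `z_c` is
nilpotent. If `n = 2 ^ d`, the anticommutator identity allows an induction that makes every `z_c`
nilpotent (`CyclicSkew.finFourier_sq_pow_eq_zero_of_two_pow`). The growth of `B` is controlled by
the commuting `z_c`, with squarefree monomials and powers of `g` as finitely many module generators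
(`CyclicSkew.finrank_pow_span_le`). Each nilpotent `z_c` therefore lowers the bound on GKdim by one.
This gives pertinency at least `φ(n)` in general. For `n = 2 ^ d` it gives exactly `n`, since `B` is
nonzero.

For reflection numbers, an element of order `m` in `W` permutes the generators in `n/m` cycles of
length `m`. It acts on the monomials by a signed permutation, and each cycle contributes `(-1) ^ (m
- 1)`, so its trace series is `(1 - (-1) ^ (m - 1) t ^ m) ^ (-n/m)`
(`SkewPoly.FreeOfOrder.traceSeries_eq`). The pole at `1` has order `n/m` for odd `m` and `0` for
even `m`, so the minimum of the reflection numbers comes from the smallest odd prime order, if there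
is one. For `n = p ^ d` with `p` odd this minimum is `φ(n)`, which the pertinency bound already
reaches. -/

noncomputable section

open Polynomial PowerSeries Filter

/-! ### Gelfand-Kirillov dimension from polynomial growth bounds -/

section GrowthOfAlgebras

variable {k : Type u} {B : Type v} [Field k] [Ring B] [Algebra k B]

theorem ENNReal.log_natCast_div_log {N : ℕ} (hN : N ≠ 0) (m : ℕ) :
    ENNReal.log ((N : ℕ) : ENNReal) / ((Real.log (m : ℝ) : ℝ) : EReal) =
      ((Real.log N / Real.log m : ℝ) : EReal) := by
  have h : ENNReal.log ((N : ℕ) : ENNReal) = ((Real.log N : ℝ) : EReal) := by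
    rw [ENNReal.log_pos_real (by exact_mod_cast hN) (by simp)]
    simp
  rw [h, EReal.coe_div]

theorem Real.tendsto_log_mul_pow_div_log {c : ℝ} (hc : 0 < c) (r : ℕ) :
    Tendsto (fun m : ℕ => Real.log (c * (m : ℝ) ^ r) / Real.log m) atTop (nhds (r : ℝ)) := by
  have hlog : Tendsto (fun m : ℕ => Real.log (m : ℝ)) atTop atTop :=
    Real.tendsto_log_atTop.comp tendsto_natCast_atTop_atTop
  have h1 : Tendsto (fun m : ℕ => Real.log c / Real.log m + r) atTop (nhds (0 + (r : ℝ))) :=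
    (hlog.const_div_atTop _).add tendsto_const_nhds
  rw [zero_add] at h1
  refine h1.congr' ?_
  filter_upwards [eventually_ge_atTop 2] with m hm
  have hm' : (2 : ℝ) ≤ m := by exact_mod_cast hm
  have hpos : 0 < Real.log m := Real.log_pos (by linarith)
  rw [Real.log_mul hc.ne' (by positivity), Real.log_pow]
  field_simp

theorem le_gkDim_of_growth {c : ℝ} (hc : 0 < c) (r : ℕ) {V : Submodule k B} (hV : V.FG)
    (h : ∀ m : ℕ, c * (m : ℝ) ^ r ≤ Module.finrank k ↥(V ^ m)) : (r : EReal) ≤ gkDim k B := by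
  refine le_trans ?_ (le_iSup₂_of_le V hV le_rfl)
  have ht : Tendsto (fun m : ℕ => ((Real.log (c * (m : ℝ) ^ r) / Real.log m : ℝ) : EReal)) atTop
      (nhds ((r : ℝ) : EReal)) :=
    (continuous_coe_real_ereal.tendsto _).comp (Real.tendsto_log_mul_pow_div_log hc r)
  have hr : (r : EReal) = ((r : ℝ) : EReal) := by simp
  rw [hr, ← ht.limsup_eq]
  refine limsup_le_limsup ?_
  filter_upwards [eventually_ge_atTop 2] with m hm
  have hm' : (2 : ℝ) ≤ m := by exact_mod_cast hm
  have hcm : 0 < c * (m : ℝ) ^ r := by positivity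
  have hN : Module.finrank k ↥(V ^ m) ≠ 0 := by
    intro h0
    have := h m
    rw [h0] at this
    simp only [Nat.cast_zero] at this
    linarith
  rw [ENNReal.log_natCast_div_log hN, EReal.coe_le_coe_iff]
  exact div_le_div_of_nonneg_right (Real.log_le_log hcm (h m)) (Real.log_nonneg (by linarith))

theorem Submodule.exists_mem_pow_of_adjoin_eq_top {W : Submodule k B} (hW : 1 ≤ W)
    (hadj : Algebra.adjoin k (W : Set B) = ⊤) (b : B) : ∃ q, b ∈ W ^ q := by
  have hb : b ∈ Algebra.adjoin k (W : Set B) := hadj ▸ Algebra.mem_top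
  induction hb using Algebra.adjoin_induction with
  | mem x hx => exact ⟨1, by simpa using hx⟩
  | algebraMap r => exact ⟨0, by simp [Submodule.mem_one]⟩
  | add x y _ _ hx hy =>
    obtain ⟨a, ha⟩ := hx
    obtain ⟨b, hb⟩ := hy
    exact ⟨max a b, add_mem (pow_le_pow_right' hW (le_max_left a b) ha)
      (pow_le_pow_right' hW (le_max_right a b) hb)⟩
  | mul x y _ _ hx hy =>
    obtain ⟨a, ha⟩ := hx
    obtain ⟨b, hb⟩ := hy
    exact ⟨a + b, by rw [pow_add]; exact Submodule.mul_mem_mul ha hb⟩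

theorem Submodule.exists_le_pow_of_adjoin_eq_top {W V : Submodule k B} (hW : 1 ≤ W)
    (hadj : Algebra.adjoin k (W : Set B) = ⊤) (hV : V.FG) : ∃ q, V ≤ W ^ q := by
  classical
  obtain ⟨S, rfl⟩ := hV
  choose f hf using Submodule.exists_mem_pow_of_adjoin_eq_top hW hadj
  refine ⟨S.sup f, Submodule.span_le.2 fun b hb => ?_⟩
  exact pow_le_pow_right' hW (Finset.le_sup (f := f) hb) (hf b)

/-- One generating subspace suffices: any finitely generated `V` lies in some `W ^ q`, so `V ^ m ≤ W
^ (q * m)`, and rescaling `m` does not change the exponent `r`. -/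
theorem gkDim_le_of_growth (C r : ℕ) {W : Submodule k B} (hfg : W.FG) (hW : 1 ≤ W)
    (hadj : Algebra.adjoin k (W : Set B) = ⊤)
    (h : ∀ m : ℕ, Module.finrank k ↥(W ^ m) ≤ C * (m + 1) ^ r) : gkDim k B ≤ r := by
  refine iSup₂_le fun V hV => ?_
  obtain ⟨q, hq⟩ := Submodule.exists_le_pow_of_adjoin_eq_top hW hadj hV
  -- The factor `(q + 1) ^ r` absorbs `q * m + 1 ≤ (q + 1) * m` for `m ≥ 1`; `C + 1` keeps the
  -- logarithm finite when `C = 0`.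
  set c : ℕ := (C + 1) * (q + 1) ^ r with hcdef
  have hc : 0 < c := by positivity
  have ht : Tendsto (fun m : ℕ => ((Real.log ((c : ℝ) * (m : ℝ) ^ r) / Real.log m : ℝ) : EReal))
      atTop (nhds ((r : ℝ) : EReal)) :=
    (continuous_coe_real_ereal.tendsto _).comp
      (Real.tendsto_log_mul_pow_div_log (by exact_mod_cast hc) r)
  have hr : (r : EReal) = ((r : ℝ) : EReal) := by simp
  rw [hr, ← ht.limsup_eq]
  refine limsup_le_limsup ?_
  filter_upwards [eventually_ge_atTop 2] with m hm
  have hm' : (2 : ℝ) ≤ m := by exact_mod_cast hm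
  have hfin : Module.Finite k ↥(W ^ (q * m)) := Module.Finite.iff_fg.2 (hfg.pow _)
  have hle : Module.finrank k ↥(V ^ m) ≤ c * m ^ r := by
    calc Module.finrank k ↥(V ^ m) ≤ Module.finrank k ↥(W ^ (q * m)) :=
          Submodule.finrank_mono (by rw [pow_mul]; exact pow_le_pow_left' hq m)
      _ ≤ C * (q * m + 1) ^ r := h _
      _ ≤ (C + 1) * ((q + 1) * m) ^ r := by
          gcongr
          · omega
          · rw [add_mul]; omega
      _ = c * m ^ r := by rw [hcdef, mul_pow, mul_assoc]
  have h0 : c * m ^ r ≠ 0 := by positivity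
  have key := ENNReal.log_natCast_div_log h0 m
  push_cast at key ⊢
  rw [← key]
  refine EReal.div_le_div_right_of_nonneg ?_ ?_
  · exact_mod_cast Real.log_nonneg (by linarith)
  · exact ENNReal.log_monotone (by exact_mod_cast hle)

/-- Nontriviality matters: over the zero ring all dimensions vanish and the value is `-∞`. -/
theorem gkDim_nonneg [Nontrivial B] : 0 ≤ gkDim k B := by
  have := le_gkDim_of_growth (k := k) (B := B) one_pos 0 (V := 1)
    (Submodule.fg_def.2 ⟨{1}, Set.finite_singleton _, Submodule.one_eq_span.symm⟩) (fun m => by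
      rw [one_pow, Submodule.one_eq_span, finrank_span_singleton one_ne_zero]
      simp)
  simpa using this

end GrowthOfAlgebras

/-! ### Words in families that commute up to sign -/

section SignCommuting

/-- Any two members of the family commute or anticommute. -/
def SignCommute {B : Type v} [Ring B] {ι : Type w} (v : ι → B) : Prop :=
  ∀ i j, v i * v j = v j * v i ∨ v i * v j = -(v j * v i)

/-- The product of a family over a multiset, taken in some chosen order. -/
def multisetWord {B : Type v} [Ring B] {ι : Type w} (v : ι → B) (μ : Multiset ι) : B :=
  (μ.toList.map v).prod

variable {k : Type u} {B : Type v} [Field k] [Ring B] [Algebra k B] {ι : Type w} {v : ι → B}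

theorem SignCommute.prod_perm (hv : SignCommute v) {l l' : List ι} (h : l.Perm l') :
    (l.map v).prod = (l'.map v).prod ∨ (l.map v).prod = -(l'.map v).prod := by
  induction h with
  | nil => simp
  | cons x _ ih => rcases ih with ih | ih <;> simp [ih]
  | swap x y l =>
    rcases hv y x with h | h <;> simp [← mul_assoc, h]
  | trans _ _ ih₁ ih₂ =>
    rcases ih₁ with ih₁ | ih₁ <;> rcases ih₂ with ih₂ | ih₂ <;> simp [ih₁, ih₂]

theorem SignCommute.prod_eq_multisetWord (hv : SignCommute v) (l : List ι) :
    (l.map v).prod = multisetWord v l ∨ (l.map v).prod = -multisetWord v l :=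
  hv.prod_perm (Multiset.coe_eq_coe.1 (by simp))

theorem SignCommute.mul_multisetWord (hv : SignCommute v) (i : ι) (μ : Multiset ι) :
    v i * multisetWord v μ = multisetWord v (i ::ₘ μ) ∨
      v i * multisetWord v μ = -multisetWord v (i ::ₘ μ) := by
  have := hv.prod_eq_multisetWord (i :: μ.toList)
  simpa [multisetWord, ← Multiset.cons_coe] using this

theorem SignCommute.multisetWord_eq_zero [DecidableEq ι] (hv : SignCommute v) {i : ι} {N : ℕ} (hi : v i ^ N = 0)
    {μ : Multiset ι} (hμ : N ≤ μ.count i) : multisetWord v μ = 0 := by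
  have hle : Multiset.replicate N i ≤ μ := Multiset.le_count_iff_replicate_le.1 hμ
  have hp : (μ.toList).Perm (List.replicate N i ++ (μ - Multiset.replicate N i).toList) := by
    rw [← Multiset.coe_eq_coe, ← Multiset.coe_add]
    simp only [Multiset.coe_toList, Multiset.coe_replicate]
    exact (add_tsub_cancel_of_le hle).symm
  rcases hv.prod_perm hp with h | h <;> simp [multisetWord, h, hi]

variable (k) in
theorem SignCommute.pow_span_le (hv : SignCommute v) (m : ℕ) :
    (Submodule.span k (insert 1 (Set.range v))) ^ m ≤
      Submodule.span k {b | ∃ μ : Multiset ι, μ.card ≤ m ∧ multisetWord v μ = b} := by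
  induction m with
  | zero =>
    rw [pow_zero, Submodule.one_eq_span]
    refine Submodule.span_mono ?_
    rintro _ rfl
    exact ⟨0, by simp, by simp [multisetWord]⟩
  | succ m ih =>
    rw [pow_succ']
    refine (mul_le_mul_right ih _).trans ?_
    rw [Submodule.span_mul_span, Submodule.span_le]
    rintro _ ⟨a, ha, _, ⟨μ, hμ, rfl⟩, rfl⟩
    rcases ha with rfl | ⟨i, rfl⟩
    · simp only [one_mul]
      exact Submodule.subset_span ⟨μ, by omega, rfl⟩
    · have hmem : multisetWord v (i ::ₘ μ) ∈
          Submodule.span k {b | ∃ μ : Multiset ι, μ.card ≤ m + 1 ∧ multisetWord v μ = b} :=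
        Submodule.subset_span ⟨i ::ₘ μ, by simpa using hμ, rfl⟩
      rcases hv.mul_multisetWord i μ with h | h
      · simpa [h] using hmem
      · simpa [h] using hmem

/-- Up to sign a word depends only on the multiplicities of its letters. A nonzero word of length at
most `m` has multiplicities below `N` on `U` and at most `m` elsewhere; these are counted. -/
theorem SignCommute.finrank_pow_span_le [Fintype ι] [DecidableEq ι] (hv : SignCommute v)
    (U : Finset ι) (N : ℕ) (hU : ∀ i ∈ U, v i ^ N = 0) (m : ℕ) :
    Module.finrank k ↥((Submodule.span k (insert 1 (Set.range v))) ^ m) ≤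
      N ^ U.card * (m + 1) ^ (Fintype.card ι - U.card) := by
  let d : ι → ℕ := fun i => if i ∈ U then N else m + 1
  let f : (∀ i, Fin (d i)) → B := fun e => multisetWord v (∑ i, (e i : ℕ) • {i})
  have hle : Submodule.span k {b | ∃ μ : Multiset ι, μ.card ≤ m ∧ multisetWord v μ = b} ≤
      Submodule.span k (Set.range f) := by
    rw [Submodule.span_le]
    rintro _ ⟨μ, hμ, rfl⟩
    by_cases h : ∃ i ∈ U, N ≤ μ.count i
    · obtain ⟨i, hi, hN⟩ := h
      rw [hv.multisetWord_eq_zero (hU i hi) hN]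
      exact zero_mem _
    · push Not at h
      have hd : ∀ i, μ.count i < d i := fun i => by
        by_cases hi : i ∈ U
        · simpa [d, hi] using h i hi
        · simpa [d, hi] using Nat.lt_succ_of_le ((Multiset.count_le_card i μ).trans hμ)
      refine Submodule.subset_span ⟨fun i => ⟨μ.count i, hd i⟩, ?_⟩
      have hsum : ∑ i, μ.count i • ({i} : Multiset ι) = μ := by
        ext j
        simp [Multiset.count_sum', Multiset.count_singleton]
      simp [f, hsum]
  have : Module.Finite k ↥(Submodule.span k (Set.range f)) :=
    Module.Finite.span_of_finite k (Set.finite_range f)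
  calc _ ≤ Module.finrank k ↥(Submodule.span k (Set.range f)) :=
        Submodule.finrank_mono ((hv.pow_span_le k m).trans hle)
    _ ≤ Fintype.card (∀ i, Fin (d i)) := finrank_range_le_card f
    _ = _ := by
      rw [Fintype.card_pi]
      simp only [Fintype.card_fin, d]
      rw [Finset.prod_ite, Finset.prod_const, Finset.prod_const]
      congr 2
      · simp
      · rw [Finset.filter_not, Finset.card_sdiff]
        simp

end SignCommuting

/-! ### Monomial basis and GK dimension of the skew polynomial ring -/

namespace SkewPoly

variable (k : Type u) [Field k] (n : ℕ)

theorem signCommute_x : SignCommute (x k n) := fun i j => by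
  by_cases h : i = j
  · exact .inl (by rw [h])
  · exact .inr (x_mul_x h)

theorem adjoin_range_x : Algebra.adjoin k (Set.range (x k n)) = ⊤ := by
  have h : (RingQuot.mkAlgHom k (Rel k n)).range = ⊤ :=
    AlgHom.range_eq_top _ |>.2 (RingQuot.mkAlgHom_surjective k _)
  rw [← h, ← Algebra.map_top, ← FreeAlgebra.adjoin_range_ι, AlgHom.map_adjoin, ← Set.range_comp]
  rfl

/-- The action of the generators on the free module on monomials. -/
def monomialShift (i : Fin n) : Module.End k (Multiset (Fin n) →₀ k) :=
  Finsupp.lsum k fun μ => (-1 : k) ^ (μ.filter (· < i)).card • Finsupp.lsingle (i ::ₘ μ)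

variable {n} in
theorem monomialShift_single (i : Fin n) (μ : Multiset (Fin n)) (c : k) :
    monomialShift k n i (Finsupp.single μ c) =
      Finsupp.single (i ::ₘ μ) ((-1) ^ (μ.filter (· < i)).card * c) := by
  simp [monomialShift]

/-- The sign in `monomialShift` counts the smaller letters that the new one passes on its way into
an increasing monomial. Inserting `i` raises the count for `j` by one, while inserting `j` leaves
the count for `i` unchanged. -/
theorem monomialShift_mul_of_lt (i j : Fin n) (h : i < j) :
    monomialShift k n i * monomialShift k n j = -(monomialShift k n j * monomialShift k n i) := by
  refine Finsupp.lhom_ext fun μ c => ?_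
  have hi : ((i ::ₘ μ).filter (· < j)).card = (μ.filter (· < j)).card + 1 := by simp [h]
  have hj : ((j ::ₘ μ).filter (· < i)).card = (μ.filter (· < i)).card := by
    rw [Multiset.filter_cons_of_neg _ (by simpa using h.le)]
  simp only [Module.End.mul_apply, LinearMap.neg_apply, monomialShift_single, hi, hj, pow_succ,
    ← Finsupp.single_neg, Multiset.cons_swap i j]
  congr 1
  ring

theorem monomialShift_mul (i j : Fin n) (h : i ≠ j) :
    monomialShift k n i * monomialShift k n j = -(monomialShift k n j * monomialShift k n i) := by
  rcases lt_or_gt_of_ne h with h | h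
  · exact monomialShift_mul_of_lt k n i j h
  · rw [monomialShift_mul_of_lt k n j i h]
    exact (neg_neg (monomialShift k n i * monomialShift k n j)).symm

/-- The action of `k_{-1}[x_1, …, x_n]` on the free module on monomials. -/
def monomialAction : SkewPoly k n →ₐ[k] Module.End k (Multiset (Fin n) →₀ k) :=
  RingQuot.liftAlgHom k ⟨FreeAlgebra.lift k (monomialShift k n), by
    rintro _ _ ⟨i, j, h⟩
    simp only [map_mul, map_neg, FreeAlgebra.lift_ι_apply]
    exact monomialShift_mul k n i j h⟩

theorem monomialAction_x (i : Fin n) : monomialAction k n (x k n i) = monomialShift k n i := by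
  simp [monomialAction, x]

theorem monomialAction_prod (l : List (Fin n)) : ∃ ε : kˣ,
    monomialAction k n (l.map (x k n)).prod (Finsupp.single 0 1) =
      Finsupp.single (l : Multiset (Fin n)) (ε : k) := by
  induction l with
  | nil => exact ⟨1, by simp⟩
  | cons i l ih =>
    obtain ⟨ε, hε⟩ := ih
    refine ⟨(-1) ^ ((l : Multiset (Fin n)).filter (· < i)).card * ε, ?_⟩
    rw [List.map_cons, List.prod_cons, map_mul, Module.End.mul_apply, hε, monomialAction_x,
      monomialShift_single]
    simp

/-- Acting on the empty monomial sends each word to a unit multiple of its own basis vector, so no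
relations beyond the obvious ones can hold. -/
theorem linearIndependent_multisetWord : LinearIndependent k (multisetWord (x k n)) := by
  let Φ : SkewPoly k n →ₗ[k] (Multiset (Fin n) →₀ k) :=
    (LinearMap.applyₗ (Finsupp.single 0 1)).comp (monomialAction k n).toLinearMap
  have h : ∀ μ : Multiset (Fin n), ∃ ε : kˣ, Φ (multisetWord (x k n) μ) =
      ε • Finsupp.single μ (1 : k) := fun μ => by
    obtain ⟨ε, hε⟩ := monomialAction_prod k n μ.toList
    refine ⟨ε, ?_⟩
    simpa [Φ, multisetWord, Units.smul_def] using hε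
  choose ε hε using h
  refine LinearIndependent.of_comp Φ ?_
  have : (Φ ∘ multisetWord (x k n)) = ε • fun μ => Finsupp.single μ (1 : k) := funext hε
  rw [this]
  exact (Finsupp.linearIndependent_single_one k _).units_smul ε

theorem x_injective : Function.Injective (x k n) := fun i j h => by
  have h1 : ∀ i, x k n i = multisetWord (x k n) {i} := by simp [multisetWord]
  rw [h1, h1] at h
  simpa using (linearIndependent_multisetWord k n).injective h

theorem permAut_apply (s : Equiv.Perm (Fin n)) (r : SkewPoly k n) :
    (permAut k n s : SkewPoly k n ≃ₐ[k] SkewPoly k n) r = permHom k n s r := rfl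

theorem permAut_injective : Function.Injective (permAut k n) := fun s t h => by
  ext i
  have : permHom k n s (x k n i) = permHom k n t (x k n i) := by
    rw [← permAut_apply, ← permAut_apply, h]
  simp only [permHom_x] at this
  rw [x_injective k n this]

instance : Nontrivial (SkewPoly k n) :=
  ⟨multisetWord (x k n) 0, 0, (linearIndependent_multisetWord k n).ne_zero 0⟩

theorem gkDim_le : gkDim k (SkewPoly k n) ≤ n := by
  refine gkDim_le_of_growth 1 n (W := Submodule.span k (insert 1 (Set.range (x k n))))
    (Submodule.fg_span ((Set.finite_range _).insert _)) ?_ ?_ fun m => ?_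
  · rw [Submodule.one_eq_span]
    exact Submodule.span_mono (by simp)
  · rw [eq_top_iff, ← adjoin_range_x]
    exact Algebra.adjoin_mono ((Set.subset_insert _ _).trans Submodule.subset_span)
  · simpa using (signCommute_x k n).finrank_pow_span_le (k := k) ∅ 0 (by simp) m

theorem multisetWord_mem_pow_card (μ : Multiset (Fin n)) :
    multisetWord (x k n) μ ∈ (Submodule.span k (Set.range (x k n))) ^ μ.card := by
  have : ∀ l : List (Fin n), (l.map (x k n)).prod ∈
      (Submodule.span k (Set.range (x k n))) ^ l.length := fun l => by
    induction l with
    | nil => simp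
    | cons i l ih =>
      rw [List.map_cons, List.prod_cons, List.length_cons, pow_succ']
      exact Submodule.mul_mem_mul (Submodule.subset_span ⟨i, rfl⟩) ih
  simpa [multisetWord] using this μ.toList

theorem le_gkDim : (n : EReal) ≤ gkDim k (SkewPoly k n) := by
  rcases Nat.eq_zero_or_pos n with rfl | hn
  · simpa using gkDim_nonneg
  set V := Submodule.span k (insert 1 (Set.range (x k n))) with hV
  have hfg : V.FG := Submodule.fg_span ((Set.finite_range _).insert _)
  -- Monomials whose exponents are all at most `m / n` have degree at most `m`, and there are `(m /
  -- n + 1) ^ n ≥ (m / n) ^ n` of them, the last quotient being real.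
  refine le_gkDim_of_growth (c := (1 / (n : ℝ)) ^ n) (by positivity) n hfg fun m => ?_
  let f : (Fin n → Fin (m / n + 1)) → Multiset (Fin n) := fun e => ∑ i, (e i : ℕ) • {i}
  have hcount : ∀ e i, (f e).count i = e i := fun e i => by
    simp [f, Multiset.count_sum', Multiset.count_singleton]
  have hf : Function.Injective f := fun e e' h => by
    ext i
    rw [← hcount, h, hcount]
  have hmem : ∀ e, multisetWord (x k n) (f e) ∈ V ^ m := fun e => by
    have h1 : (f e).card ≤ m := by
      have : (f e).card ≤ n * (m / n) := by
        simp only [f, Multiset.card_sum, Multiset.card_nsmul, Multiset.card_singleton, mul_one]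
        calc ∑ i, (e i : ℕ) ≤ ∑ _i : Fin n, m / n :=
              Finset.sum_le_sum fun i _ => Nat.lt_succ_iff.1 (e i).2
          _ = n * (m / n) := by simp
      exact this.trans (Nat.mul_div_le m n)
    have h2 : (1 : Submodule k (SkewPoly k n)) ≤ V := by
      rw [Submodule.one_eq_span]
      exact Submodule.span_mono (by simp)
    exact pow_le_pow_right' h2 h1 (pow_le_pow_left' (Submodule.span_mono (Set.subset_insert _ _)) _
      (multisetWord_mem_pow_card k n (f e)))
  have hfin : Module.Finite k ↥(V ^ m) := Module.Finite.iff_fg.2 (hfg.pow _)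
  have hli : LinearIndependent k fun e => (⟨_, hmem e⟩ : ↥(V ^ m)) := by
    refine LinearIndependent.of_comp (V ^ m).subtype ?_
    exact (linearIndependent_multisetWord k n).comp f hf
  have hcard := hli.fintype_card_le_finrank
  simp only [Fintype.card_pi, Fintype.card_fin, Finset.prod_const, Finset.card_univ] at hcard
  calc (1 / (n : ℝ)) ^ n * (m : ℝ) ^ n = ((m : ℝ) / n) ^ n := by rw [← mul_pow]; congr 1; ring
    _ ≤ ((m / n + 1 : ℕ) : ℝ) ^ n := by
      gcongr
      rw [div_le_iff₀ (by exact_mod_cast hn)]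
      have := Nat.lt_div_mul_add (a := m) hn
      exact_mod_cast (show m ≤ (m / n + 1) * n by rw [add_mul]; omega)
    _ ≤ _ := by exact_mod_cast hcard

theorem gkDim_eq : gkDim k (SkewPoly k n) = n := le_antisymm (gkDim_le k n) (le_gkDim k n)

end SkewPoly

/-! ### Discrete Fourier transform over a primitive root of unity -/

section Fourier

variable {K : Type u} [Field K] {n : ℕ} {ω : K}

theorem IsPrimitiveRoot.pow_finRotate (hω : IsPrimitiveRoot ω n) (i : Fin n) :
    ω ^ (finRotate n i : ℕ) = ω * ω ^ (i : ℕ) := by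
  cases n with
  | zero => exact i.elim0
  | succ n =>
    rw [coe_finRotate, ← pow_succ']
    split_ifs with h
    · rw [h, Fin.val_last, pow_zero, hω.pow_eq_one]
    · rfl

theorem IsPrimitiveRoot.zpow_mul_finRotate [NeZero n] (hω : IsPrimitiveRoot ω n) (a : ℤ)
    (i : Fin n) : ω ^ (a * (finRotate n i : ℕ)) = ω ^ a * ω ^ (a * (i : ℕ)) := by
  have h := hω.pow_finRotate i
  simp only [mul_comm a, zpow_mul, zpow_natCast, h, mul_zpow]

theorem IsPrimitiveRoot.sum_zpow_mul_sub [NeZero n] (hω : IsPrimitiveRoot ω n) (i j : Fin n) :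
    ∑ c : Fin n, ω ^ (-((c : ℕ) * (i : ℕ) : ℤ) + (c : ℕ) * (j : ℕ)) =
      if i = j then (n : K) else 0 := by
  have h0 : ω ≠ 0 := hω.ne_zero (NeZero.ne n)
  set η : K := ω ^ ((j : ℕ) - (i : ℕ) : ℤ) with hη
  have h1 : ∀ c : Fin n, ω ^ (-((c : ℕ) * (i : ℕ) : ℤ) + (c : ℕ) * (j : ℕ)) = η ^ (c : ℕ) := by
    intro c
    rw [hη, ← zpow_natCast, ← zpow_mul]
    congr 1
    ring
  rw [Finset.sum_congr rfl fun c _ => h1 c, Fin.sum_univ_eq_sum_range (fun c => η ^ c)]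
  split_ifs with h
  · simp [hη, h]
  · have hn1 : η ^ n = 1 := by
      rw [hη, ← zpow_natCast, ← zpow_mul, mul_comm, zpow_mul, zpow_natCast, hω.pow_eq_one, one_zpow]
    have hne : η ≠ 1 := by
      rw [hη, Ne, hω.zpow_eq_one_iff_dvd]
      intro hd
      apply h
      have h2 := Int.eq_zero_of_abs_lt_dvd hd (by
        rw [abs_lt]
        constructor <;> omega)
      ext
      omega
    have := mul_geom_sum η n
    rw [hn1, sub_self] at this
    exact (mul_eq_zero.1 this).resolve_left (sub_ne_zero.2 hne)

variable {M : Type v} [AddCommGroup M] [Module K M]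

/-- The discrete Fourier transform of a family indexed by `Fin n`. -/
def finFourier (ω : K) (f : Fin n → M) (a : ℤ) : M :=
  ∑ i : Fin n, ω ^ (a * (i : ℕ)) • f i

theorem sum_zpow_smul_finRotate [NeZero n] (hω : IsPrimitiveRoot ω n) (f : Fin n → M) (a : ℤ) :
    ∑ i : Fin n, ω ^ (a * (i : ℕ)) • f (finRotate n i) = ω ^ (-a) • finFourier ω f a := by
  have h0 : ω ≠ 0 := hω.ne_zero (NeZero.ne n)
  rw [finFourier, ← Equiv.sum_comp (finRotate n) fun i => ω ^ (a * (i : ℕ)) • f i,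
    Finset.smul_sum]
  refine Finset.sum_congr rfl fun i _ => ?_
  rw [smul_smul, hω.zpow_mul_finRotate, ← mul_assoc, ← zpow_add₀ h0]
  simp

theorem finFourier_inversion [NeZero n] (hω : IsPrimitiveRoot ω n) (hn : (n : K) ≠ 0)
    (f : Fin n → M) (i : Fin n) :
    f i = (n : K)⁻¹ • ∑ c : Fin n, ω ^ (-((c : ℕ) * (i : ℕ) : ℤ)) • finFourier ω f (c : ℕ) := by
  have h0 : ω ≠ 0 := hω.ne_zero (NeZero.ne n)
  have h1 : ∀ c : Fin n, ω ^ (-((c : ℕ) * (i : ℕ) : ℤ)) • finFourier ω f (c : ℕ) =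
      ∑ j : Fin n, ω ^ (-((c : ℕ) * (i : ℕ) : ℤ) + (c : ℕ) * (j : ℕ)) • f j := fun c => by
    rw [finFourier, Finset.smul_sum]
    refine Finset.sum_congr rfl fun j _ => ?_
    rw [smul_smul, zpow_add₀ h0]
  rw [Finset.sum_congr rfl fun c _ => h1 c, Finset.sum_comm]
  simp only [← Finset.sum_smul, hω.sum_zpow_mul_sub, ite_smul, zero_smul, Finset.sum_ite_eq,
    Finset.mem_univ, if_true]
  rw [inv_smul_smul₀ hn]

end Fourier

/-! ### Weights and nilpotent Fourier modes in the quotient -/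

section CyclicSkew

/-- Pairwise anticommuting elements `x i`, cyclically permuted by conjugation with an element `g`
such that `g ^ n = 1` and `∑ g ^ i = 0`. -/
structure CyclicSkew {B : Type v} [Ring B] {n : ℕ} (x : Fin n → B) (g : B) : Prop where
  anticomm : ∀ i j, i ≠ j → x i * x j = -(x j * x i)
  rotate : ∀ i, g * x i = x (finRotate n i) * g
  pow_eq_one : g ^ n = 1
  sum_pow : ∑ j : Fin n, g ^ (j : ℕ) = 0

namespace CyclicSkew

section Ring

variable {B : Type v} [Ring B] {n : ℕ} {x : Fin n → B} {g : B}

theorem map (h : CyclicSkew x g) {B' : Type w} [Ring B'] (f : B →+* B') :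
    CyclicSkew (fun i => f (x i)) (f g) where
  anticomm i j hij := by rw [← map_mul, h.anticomm i j hij, map_neg, map_mul]
  rotate i := by rw [← map_mul, h.rotate, map_mul]
  pow_eq_one := by rw [← map_pow, h.pow_eq_one, map_one]
  sum_pow := by simp only [← map_pow, ← map_sum, h.sum_pow, map_zero]

theorem signCommute (h : CyclicSkew x g) : SignCommute x := fun i j => by
  by_cases hij : i = j
  · exact .inl (by rw [hij])
  · exact .inr (h.anticomm i j hij)

theorem sq_comm (h : CyclicSkew x g) (i j : Fin n) : x i * x j ^ 2 = x j ^ 2 * x i := by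
  rcases h.signCommute i j with hc | hc
  · rw [pow_two, ← mul_assoc, hc, mul_assoc, hc, mul_assoc]
  · rw [pow_two, ← mul_assoc, hc, neg_mul, mul_assoc, hc, mul_neg, neg_neg, mul_assoc]

theorem rotate_sq (h : CyclicSkew x g) (i : Fin n) :
    g * x i ^ 2 = x (finRotate n i) ^ 2 * g := by
  rw [pow_two, ← mul_assoc, h.rotate, mul_assoc, h.rotate, ← mul_assoc, pow_two]

theorem rotate_prod (h : CyclicSkew x g) (l : List (Fin n)) :
    g * (l.map x).prod = ((l.map (finRotate n)).map x).prod * g := by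
  induction l with
  | nil => simp
  | cons i l ih =>
    simp only [List.map_cons, List.prod_cons]
    rw [← mul_assoc, h.rotate, mul_assoc, ih, mul_assoc]

theorem mul_pow_val (h : CyclicSkew x g) (j : Fin n) :
    g * g ^ (j : ℕ) = g ^ (finRotate n j : ℕ) := by
  cases n with
  | zero => exact j.elim0
  | succ n =>
    rw [coe_finRotate, ← pow_succ']
    split_ifs with hj
    · rw [hj, Fin.val_last, pow_zero, h.pow_eq_one]
    · rfl

end Ring

variable {K : Type u} {B : Type v} [Field K] [Ring B] [Algebra K B] {n : ℕ}
  {x : Fin n → B} {g : B} {ω : K}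

/-- Every power of `g` fixes `b`, so `n • b = (∑ g ^ j) * b = 0`. -/
theorem eq_zero_of_mul_eq [NeZero n] (h : CyclicSkew x g) (hn : (n : K) ≠ 0) {b : B} (hb : g * b = b) :
    b = 0 := by
  have h1 : ∀ j : ℕ, g ^ j * b = b := fun j => by
    induction j with
    | zero => simp
    | succ j ih => rw [pow_succ, mul_assoc, hb, ih]
  have h2 : (∑ j : Fin n, g ^ (j : ℕ)) * b = (n : K) • b := by
    rw [Finset.sum_mul, Finset.sum_congr rfl fun (j : Fin n) _ => h1 j]
    simp [Nat.cast_smul_eq_nsmul]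
  rw [h.sum_pow, zero_mul] at h2
  exact (smul_eq_zero.1 h2.symm).resolve_left hn

/-- Fourier inversion applied to `j ↦ g ^ j * b` at `j = 0` writes `b` as a combination of
eigenvectors of left multiplication by `g`, so annihilation can be tested on eigenvectors. -/
theorem eq_zero_of_mul_weight [NeZero n] (h : CyclicSkew x g) (hω : IsPrimitiveRoot ω n) (hn : (n : K) ≠ 0)
    {b c : B} (hb : ∀ (s : ℤ) (b : B), g * b = ω ^ s • b → c * b = 0) : c * b = 0 := by
  have h1 := finFourier_inversion hω hn (fun j : Fin n => g ^ (j : ℕ) * b) 0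
  simp only [Fin.val_zero, pow_zero, one_mul] at h1
  rw [h1, mul_smul_comm, Finset.mul_sum, Finset.sum_eq_zero, smul_zero]
  intro a _
  rw [mul_smul_comm, hb (-(a : ℕ)), smul_zero]
  rw [← sum_zpow_smul_finRotate hω, finFourier, Finset.mul_sum]
  refine Finset.sum_congr rfl fun j _ => ?_
  rw [mul_smul_comm, ← mul_assoc, h.mul_pow_val]

theorem mul_finFourier [NeZero n] (hω : IsPrimitiveRoot ω n) {u : Fin n → B}
    (hu : ∀ i, g * u i = u (finRotate n i) * g) (a : ℤ) :
    g * finFourier ω u a = ω ^ (-a) • (finFourier ω u a * g) := by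
  rw [← smul_mul_assoc, ← sum_zpow_smul_finRotate hω, finFourier, Finset.mul_sum, Finset.sum_mul]
  refine Finset.sum_congr rfl fun j _ => ?_
  rw [mul_smul_comm, hu, smul_mul_assoc]

theorem weight_finFourier_mul [NeZero n] (hω : IsPrimitiveRoot ω n) {u : Fin n → B}
    (hu : ∀ i, g * u i = u (finRotate n i) * g) (a : ℤ) {s : ℤ} {b : B} (hb : g * b = ω ^ s • b) :
    g * (finFourier ω u a * b) = ω ^ (s - a) • (finFourier ω u a * b) := by
  rw [← mul_assoc, mul_finFourier hω hu, smul_mul_assoc, mul_assoc, hb, mul_smul_comm, smul_smul,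
    ← zpow_add₀ (hω.ne_zero (NeZero.ne n))]
  congr 2
  ring

theorem eq_zero_of_weight [NeZero n] (h : CyclicSkew x g) (hω : IsPrimitiveRoot ω n) (hn : (n : K) ≠ 0)
    {s : ℤ} (hs : (n : ℤ) ∣ s) {b : B} (hb : g * b = ω ^ s • b) : b = 0 := by
  rw [(hω.zpow_eq_one_iff_dvd s).2 hs, one_smul] at hb
  exact h.eq_zero_of_mul_eq hn hb

theorem weight_pow_mul [NeZero n] (h : CyclicSkew x g) (hω : IsPrimitiveRoot ω n) (c : ℤ) (j : ℕ) {s : ℤ}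
    {b : B} (hb : g * b = ω ^ s • b) :
    g * (finFourier ω (fun i => x i ^ 2) c ^ j * b) =
      ω ^ (s - j * c) • (finFourier ω (fun i => x i ^ 2) c ^ j * b) := by
  induction j with
  | zero => simpa using hb
  | succ j ih =>
    rw [pow_succ', mul_assoc, weight_finFourier_mul hω h.rotate_sq c ih]
    congr 2
    push_cast
    ring

/-- Each factor lowers the weight by `c`. As `c` is invertible modulo `n`, some `j < n` factors
bring a given weight `s` to zero, where there is nothing left. -/
theorem finFourier_sq_pow_eq_zero [NeZero n] (h : CyclicSkew x g) (hω : IsPrimitiveRoot ω n)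
    (hn : (n : K) ≠ 0) {c : ℕ} (hc : c.Coprime n) :
    finFourier ω (fun i => x i ^ 2) c ^ n = 0 := by
  rw [← mul_one (finFourier ω (fun i => x i ^ 2) c ^ n)]
  refine h.eq_zero_of_mul_weight hω hn fun s b hb => ?_
  -- Solve `u * c ≡ s` modulo `n` by a Bézout relation; the number of factors `j` is `u` reduced
  -- modulo `n`.
  obtain ⟨u, hu⟩ : ∃ u : ℤ, (n : ℤ) ∣ s - u * c := by
    have hco : IsCoprime (c : ℤ) n := Nat.isCoprime_iff_coprime.2 hc
    obtain ⟨p, q, hpq⟩ := hco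
    refine ⟨s * p, s * q, ?_⟩
    linear_combination (-s) * hpq
  have hn0 : (0 : ℤ) < n := by exact_mod_cast NeZero.pos n
  obtain ⟨j, hj⟩ := Int.eq_ofNat_of_zero_le (Int.emod_nonneg u hn0.ne')
  have hjn : j < n := by
    have := Int.emod_lt_of_pos u hn0
    omega
  have hd : (n : ℤ) ∣ s - j * c := by
    have h1 : (n : ℤ) ∣ u - j := by
      rw [← hj]
      exact Int.dvd_self_sub_emod
    have : s - j * c = (s - u * c) + (u - j) * c := by ring
    rw [this]
    exact dvd_add hu (h1.mul_right _)
  have h0 := h.eq_zero_of_weight hω hn hd (h.weight_pow_mul hω c j hb)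
  rw [← pow_sub_mul_pow _ hjn.le, mul_assoc, h0, mul_zero]

/-- Anticommutation cancels all terms with distinct indices, leaving only the squares. -/
theorem finFourier_mul_add [NeZero n] (h : CyclicSkew x g) (hω : IsPrimitiveRoot ω n) (a b : ℤ) :
    finFourier ω x a * finFourier ω x b + finFourier ω x b * finFourier ω x a =
      (2 : K) • finFourier ω (fun i => x i ^ 2) (a + b) := by
  have h0 : ω ≠ 0 := hω.ne_zero (NeZero.ne n)
  simp only [finFourier]
  rw [Finset.sum_mul_sum, Finset.sum_mul_sum, Finset.sum_comm, ← Finset.sum_add_distrib,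
    Finset.smul_sum]
  refine Finset.sum_congr rfl fun j _ => ?_
  rw [← Finset.sum_add_distrib, Finset.sum_eq_single j]
  · simp only [smul_mul_smul_comm, ← zpow_add₀ h0, add_mul, two_smul, pow_two, add_comm]
  · intro i _ hij
    simp only [smul_mul_smul_comm, h.anticomm i j hij, smul_neg]
    rw [mul_comm, neg_add_cancel]
  · simp

theorem commute_finFourier_sq (h : CyclicSkew x g) (c : ℤ) (i : Fin n) :
    x i * finFourier ω (fun i => x i ^ 2) c = finFourier ω (fun i => x i ^ 2) c * x i := by
  simp only [finFourier, Finset.mul_sum, Finset.sum_mul, mul_smul_comm, smul_mul_assoc,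
    h.sq_comm i]

theorem finFourier_commute_finFourier_sq (h : CyclicSkew x g) (a c : ℤ) :
    Commute (finFourier ω x a) (finFourier ω (fun i => x i ^ 2) c) := by
  rw [Commute, SemiconjBy, finFourier.eq_def ω x, Finset.sum_mul, Finset.mul_sum]
  refine Finset.sum_congr rfl fun i _ => ?_
  rw [smul_mul_assoc, h.commute_finFourier_sq, mul_smul_comm]

theorem finFourier_sq_commute (h : CyclicSkew x g) (a c : ℤ) :
    finFourier ω (fun i => x i ^ 2) a * finFourier ω (fun i => x i ^ 2) c =
      finFourier ω (fun i => x i ^ 2) c * finFourier ω (fun i => x i ^ 2) a := by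
  rw [finFourier.eq_def ω _ a, Finset.sum_mul, Finset.mul_sum]
  refine Finset.sum_congr rfl fun i _ => ?_
  rw [smul_mul_assoc, pow_two, mul_assoc, h.commute_finFourier_sq, ← mul_assoc,
    h.commute_finFourier_sq, mul_assoc, mul_smul_comm]

/-- On `b` of weight `s`, `y_s * b` has weight zero and vanishes, so `2 z_c b = y_s y_(c-s) b`. Here
`y_(c-s) b` has weight `2 s - c`, whose distance from `c` is `2 (s - c)`: each factor `z_c` gains a
factor two in the distance. After `d` steps the distance is divisible by `n = 2 ^ d`, and one more
`z_c` lands in weight zero. -/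
theorem finFourier_sq_pow_eq_zero_of_two_pow [NeZero n] (h : CyclicSkew x g) (hω : IsPrimitiveRoot ω n)
    (hn : (n : K) ≠ 0) (h2 : (2 : K) ≠ 0) {d : ℕ} (hd : n = 2 ^ d) (c : ℤ) :
    finFourier ω (fun i => x i ^ 2) c ^ (d + 1) = 0 := by
  have key : ∀ (e : ℕ) (s : ℤ) (b : B), (n : ℤ) ∣ 2 ^ e * (s - c) → g * b = ω ^ s • b →
      finFourier ω (fun i => x i ^ 2) c ^ (e + 1) * b = 0 := by
    intro e
    induction e with
    | zero =>
      intro s b hs hb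
      have := h.weight_pow_mul hω c 1 hb
      exact h.eq_zero_of_weight hω hn (by simpa using hs) this
    | succ e ih =>
      intro s b hs hb
      have hys : finFourier ω x s * b = 0 :=
        h.eq_zero_of_weight hω hn (s := s - s) (by simp) (weight_finFourier_mul hω h.rotate s hb)
      have hy := weight_finFourier_mul hω h.rotate (c - s) hb
      -- The new weight `s - (c - s)` differs from `c` by `2 * (s - c)`, so one power of two moves
      -- into the distance.
      have h3 := ih (s - (c - s)) _ (by
        have : (2 : ℤ) ^ e * (s - (c - s) - c) = 2 ^ (e + 1) * (s - c) := by ring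
        rwa [this]) hy
      have h4 := h.finFourier_mul_add hω s (c - s)
      rw [add_sub_cancel] at h4
      have h5 : (2 : K) • (finFourier ω (fun i => x i ^ 2) c * b) =
          finFourier ω x s * (finFourier ω x (c - s) * b) := by
        rw [← smul_mul_assoc, ← h4, add_mul, mul_assoc, mul_assoc, hys, mul_zero, add_zero]
      have h6 : (2 : K) • (finFourier ω (fun i => x i ^ 2) c ^ (e + 1 + 1) * b) = 0 := by
        -- `y_s` commutes with the powers of `z_c`, so it can be moved left until `h3` applies.
        rw [pow_succ, mul_assoc, ← mul_smul_comm, h5, ← mul_assoc,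
          ← ((h.finFourier_commute_finFourier_sq s c).pow_right (e + 1)).eq, mul_assoc, h3,
          mul_zero]
      exact (smul_eq_zero.1 h6).resolve_left h2
  rw [← mul_one (finFourier ω (fun i => x i ^ 2) c ^ (d + 1))]
  refine h.eq_zero_of_mul_weight hω hn fun s b hb => key d s b ?_ hb
  rw [hd]
  exact ⟨s - c, by push_cast; rfl⟩

end CyclicSkew

end CyclicSkew

/-! ### Dimension estimates and extension of scalars -/

section DimensionBounds

theorem Submodule.finrank_mul_le {K : Type u} {B : Type v} [Field K] [Ring B] [Algebra K B]
    (M N : Submodule K B) (hM : M.FG) (hN : N.FG) :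
    Module.finrank K ↥(M * N) ≤ Module.finrank K M * Module.finrank K N := by
  have : Module.Finite K M := Module.Finite.iff_fg.2 hM
  have : Module.Finite K N := Module.Finite.iff_fg.2 hN
  rw [← Submodule.mulMap_range, ← Module.finrank_tensorProduct]
  exact LinearMap.finrank_range_le _

open scoped TensorProduct in
/-- Extension of scalars does not change the growth of a finite set of generators. -/
theorem finrank_pow_span_le_tensorProduct (k : Type u) (K : Type w) {A : Type v} [Field k]
    [Field K] [Algebra k K] [Ring A] [Algebra k A] (S : Set A) (hS : S.Finite) (m : ℕ) :
    Module.finrank k ↥(Submodule.span k S ^ m) ≤ Module.finrank K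
      ↥(Submodule.span K ((Algebra.TensorProduct.includeRight : A →ₐ[k] K ⊗[k] A) '' S) ^ m) := by
  set ι : A →ₐ[k] K ⊗[k] A := Algebra.TensorProduct.includeRight
  set P := Submodule.span k S ^ m
  have h1 : Module.finrank k P = Module.finrank K (P.baseChange K) := by
    rw [← (Submodule.toBaseChange.toLinearEquiv K P).finrank_eq, Module.finrank_baseChange]
  have hfg : (Submodule.span K (ι '' S) ^ m).FG := (Submodule.fg_span (hS.image ι)).pow m
  have : Module.Finite K ↥(Submodule.span K (ι '' S) ^ m) := Module.Finite.iff_fg.2 hfg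
  rw [h1]
  refine Submodule.finrank_mono ?_
  rw [Submodule.baseChange_eq_span, Submodule.span_le]
  rintro _ ⟨p, hp, rfl⟩
  -- It suffices that the scalar extension of the `m`-th power lies in the `m`-th power of the
  -- extended span, which is checked on pure tensors by induction on the exponent.
  have h2 : ∀ (j : ℕ) (a : A), a ∈ Submodule.span k S ^ j →
      ι a ∈ Submodule.span K (ι '' S) ^ j := fun j => by
    induction j with
    | zero =>
      intro a ha
      rw [pow_zero] at ha ⊢
      obtain ⟨r, rfl⟩ := Submodule.mem_one.1 ha
      rw [AlgHom.commutes, IsScalarTower.algebraMap_apply k K]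
      exact Submodule.algebraMap_mem _
    | succ j ih =>
      intro a ha
      rw [pow_succ] at ha ⊢
      induction ha using Submodule.mul_induction_on' with
      | mem_mul_mem a ha b hb =>
        rw [map_mul]
        refine Submodule.mul_mem_mul (ih a ha) ?_
        induction hb using Submodule.span_induction with
        | mem b hb => exact Submodule.subset_span ⟨b, hb, rfl⟩
        | zero => simp
        | add b c _ _ hb hc => rw [map_add]; exact add_mem hb hc
        | smul r b _ hb =>
          rw [map_smul, ← algebraMap_smul K r]
          exact Submodule.smul_mem _ _ hb
      | add a _ b _ ha hb => rw [map_add]; exact add_mem ha hb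
  exact h2 m p hp

end DimensionBounds

namespace CyclicSkew

variable {K : Type u} {B : Type v} [Field K] [Ring B] [Algebra K B] {n : ℕ} {x : Fin n → B}
  {g : B}

-- Let `D` be spanned by `1` and the `z_c`, `Y` by `1` and the generators, `E` by squarefree
-- monomials and `G` by powers of `g`. Then `Y E G ≤ D E G` and `Y D ≤ D Y`, so `Y ^ m ≤ D ^ m E G`.
-- The factor `E G` is finite-dimensional and the `z_c` commute, so the growth is that of monomials
-- in the `z_c`.
open scoped Pointwise in
theorem finrank_pow_span_le (h : CyclicSkew x g) [NeZero n] {ω : K} (hω : IsPrimitiveRoot ω n)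
    (hn : (n : K) ≠ 0) (U : Finset (Fin n)) (N : ℕ)
    (hU : ∀ c ∈ U, finFourier ω (fun i => x i ^ 2) (c : ℕ) ^ N = 0) :
    ∃ C : ℕ, ∀ m : ℕ,
      Module.finrank K ↥(Submodule.span K (insert 1 (insert g (Set.range x))) ^ m) ≤
        C * (m + 1) ^ (n - U.card) := by
  classical
  set z : Fin n → B := fun c => finFourier ω (fun i => x i ^ 2) (c : ℕ) with hz
  set D := Submodule.span K (insert 1 (Set.range z)) with hD
  set Y := Submodule.span K (insert 1 (insert g (Set.range x))) with hY
  set E := Submodule.span K (Set.range fun s : Finset (Fin n) => multisetWord x s.val) with hE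
  set G := Submodule.span K (Set.range fun j : Fin n => g ^ (j : ℕ)) with hG
  have hDfg : D.FG := Submodule.fg_span ((Set.finite_range _).insert _)
  have hX : (E * G).FG :=
    (Submodule.fg_span (Set.finite_range _)).mul (Submodule.fg_span (Set.finite_range _))
  have hD1 : (1 : Submodule K B) ≤ D := by
    rw [Submodule.one_eq_span]
    exact Submodule.span_mono (by simp)
  have hXD : E * G ≤ D * (E * G) := by
    simpa using mul_le_mul_left hD1 (E * G)
  have hwE : ∀ s : Finset (Fin n), multisetWord x s.val ∈ E :=
    fun s => Submodule.subset_span ⟨s, rfl⟩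
  have hxD : ∀ i, x i ^ 2 ∈ D := fun i => by
    rw [finFourier_inversion hω hn (fun i => x i ^ 2) i]
    refine Submodule.smul_mem _ _ (Submodule.sum_mem _ fun c _ => Submodule.smul_mem _ _ ?_)
    exact Submodule.subset_span (Or.inr ⟨c, rfl⟩)
  -- A repeated letter is pulled out as `x i ^ 2`, which Fourier inversion expresses through the
  -- `z_c`; a new letter keeps the monomial squarefree.
  have hxE : ∀ i (s : Finset (Fin n)), x i * multisetWord x s.val ∈ D * E := by
    intro i s
    by_cases hi : i ∈ s
    · have hs : s.val = i ::ₘ (s.erase i).val := by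
        rw [Finset.erase_val, Multiset.cons_erase hi]
      have hw := h.signCommute.mul_multisetWord i (s.erase i).val
      rw [← hs] at hw
      have hm : x i ^ 2 * multisetWord x (s.erase i).val ∈ D * E :=
        Submodule.mul_mem_mul (hxD i) (hwE _)
      rw [pow_two, mul_assoc] at hm
      rcases hw with hw | hw
      · rwa [hw] at hm
      · rw [hw, mul_neg] at hm
        exact neg_mem_iff.1 hm
    · have hs : i ::ₘ s.val = (insert i s).val := (Finset.insert_val_of_notMem hi).symm
      have hm : multisetWord x (insert i s).val ∈ D * E := by
        simpa using Submodule.mul_mem_mul (hD1 (Submodule.one_le.1 le_rfl)) (hwE (insert i s))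
      rcases h.signCommute.mul_multisetWord i s.val with hw | hw
      · rwa [hw, hs]
      · rw [hw, hs]
        exact neg_mem hm
  have hgE : ∀ s : Finset (Fin n), ∃ e ∈ E, g * multisetWord x s.val = e * g := by
    intro s
    refine ⟨_, ?_, h.rotate_prod s.val.toList⟩
    have hs : (((s.val.toList).map (finRotate n) : List (Fin n)) : Multiset (Fin n)) =
        (s.map (finRotate n).toEmbedding).val := by
      rw [← Multiset.map_coe, Multiset.coe_toList]
      rfl
    have := h.signCommute.prod_eq_multisetWord ((s.val.toList).map (finRotate n))
    rw [hs] at this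
    rcases this with h' | h'
    · rw [h']
      exact hwE _
    · rw [h']
      exact neg_mem (hwE _)
  have hYX : Y * (E * G) ≤ D * (E * G) := by
    have hEG : Y * (E * G) = Submodule.span K (insert 1 (insert g (Set.range x)) *
        ((Set.range fun s : Finset (Fin n) => multisetWord x s.val) *
          Set.range fun j : Fin n => g ^ (j : ℕ))) := by
      rw [hE, hG, hY, Submodule.span_mul_span, Submodule.span_mul_span]
    rw [hEG, Submodule.span_le]
    rintro _ ⟨y, hy, _, ⟨_, ⟨s, rfl⟩, _, ⟨j, rfl⟩, rfl⟩, rfl⟩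
    have hg : g ^ (j : ℕ) ∈ G := Submodule.subset_span ⟨j, rfl⟩
    rcases hy with rfl | rfl | ⟨i, rfl⟩
    · simp only [one_mul]
      exact hXD (Submodule.mul_mem_mul (hwE s) hg)
    · obtain ⟨e, he, hes⟩ := hgE s
      change y * (multisetWord x s.val * y ^ (j : ℕ)) ∈ D * (E * G)
      rw [← mul_assoc y, hes, mul_assoc, h.mul_pow_val]
      exact hXD (Submodule.mul_mem_mul he (Submodule.subset_span ⟨_, rfl⟩))
    · change x i * (multisetWord x s.val * g ^ (j : ℕ)) ∈ D * (E * G)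
      rw [← mul_assoc, ← mul_assoc]
      exact Submodule.mul_mem_mul (hxE i s) hg
  have hYD : Y * D ≤ D * Y := by
    rw [hY, hD, Submodule.span_mul_span, ← hD, Submodule.span_le, ← hY]
    have hYmem : ∀ y ∈ insert 1 (insert g (Set.range x)), y ∈ Y :=
      fun y hy => Submodule.subset_span hy
    have hDmem : ∀ y ∈ insert 1 (Set.range z), y ∈ D := fun y hy => Submodule.subset_span hy
    rintro _ ⟨y, hy, _, rfl | ⟨c, rfl⟩, rfl⟩
    · have := Submodule.mul_mem_mul (hDmem 1 (by simp)) (hYmem y hy)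
      simpa using this
    · have hc := hDmem (z c) (by simp)
      have hm := Submodule.mul_mem_mul hc (hYmem y hy)
      rcases hy with rfl | rfl | ⟨i, rfl⟩
      · simpa using hm
      · simp only [hz]
        rw [mul_finFourier hω h.rotate_sq]
        exact Submodule.smul_mem _ _ hm
      · simp only [hz]
        rwa [h.commute_finFourier_sq]
  have hYDm : ∀ m : ℕ, Y * D ^ m ≤ D ^ m * Y := fun m => by
    induction m with
    | zero => simp
    | succ m ih =>
      calc Y * D ^ (m + 1) = Y * D ^ m * D := by rw [pow_succ, mul_assoc]
        _ ≤ D ^ m * Y * D := mul_le_mul_left ih _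
        _ = D ^ m * (Y * D) := mul_assoc _ _ _
        _ ≤ D ^ m * (D * Y) := mul_le_mul_right hYD _
        _ = D ^ (m + 1) * Y := by rw [pow_succ, mul_assoc]
  have hYm : ∀ m : ℕ, Y ^ m * (E * G) ≤ D ^ m * (E * G) := fun m => by
    induction m with
    | zero => simp
    | succ m ih =>
      calc Y ^ (m + 1) * (E * G) = Y * (Y ^ m * (E * G)) := by rw [pow_succ', mul_assoc]
        _ ≤ Y * (D ^ m * (E * G)) := mul_le_mul_right ih _
        _ = Y * D ^ m * (E * G) := (mul_assoc _ _ _).symm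
        _ ≤ D ^ m * Y * (E * G) := mul_le_mul_left (hYDm m) _
        _ = D ^ m * (Y * (E * G)) := mul_assoc _ _ _
        _ ≤ D ^ m * (D * (E * G)) := mul_le_mul_right hYX _
        _ = D ^ (m + 1) * (E * G) := by rw [pow_succ, mul_assoc]
  have hX1 : (1 : Submodule K B) ≤ E * G := by
    rw [Submodule.one_le]
    have h1 := hwE ∅
    have h2 : g ^ ((0 : Fin n) : ℕ) ∈ G := Submodule.subset_span ⟨0, rfl⟩
    simpa [multisetWord] using Submodule.mul_mem_mul h1 h2
  have hsc : SignCommute z := fun a b => .inl (h.finFourier_sq_commute _ _)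
  refine ⟨N ^ U.card * Module.finrank K ↥(E * G), fun m => ?_⟩
  have hfin : Module.Finite K ↥(D ^ m * (E * G)) := Module.Finite.iff_fg.2 ((hDfg.pow m).mul hX)
  calc Module.finrank K ↥(Y ^ m) ≤ Module.finrank K ↥(D ^ m * (E * G)) := by
        refine Submodule.finrank_mono (le_trans ?_ (hYm m))
        simpa using mul_le_mul_right hX1 (Y ^ m)
    _ ≤ Module.finrank K ↥(D ^ m) * Module.finrank K ↥(E * G) :=
        Submodule.finrank_mul_le _ _ (hDfg.pow m) hX
    _ ≤ N ^ U.card * (m + 1) ^ (n - U.card) * Module.finrank K ↥(E * G) := by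
        gcongr
        simpa using hsc.finrank_pow_span_le (k := K) U N hU m
    _ = _ := by ring

end CyclicSkew

namespace CyclicSkew

variable {k : Type u} {A : Type v} [Field k] [Ring A] [Algebra k A] {n : ℕ} [NeZero n]
  {x : Fin n → A} {g : A}

open scoped TensorProduct

/-- The root `ω` is obtained by passing to the cyclotomic field, which does not lower the dimensions
of powers of the generating space. The relations survive base change, so nilpotency is only asked of
algebras over that field. -/
theorem gkDim_le_sub_card (h : CyclicSkew x g) (hn : (n : k) ≠ 0)
    (hadj : Algebra.adjoin k (insert g (Set.range x)) = ⊤) (U : Finset (Fin n)) (N : ℕ)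
    (hU : ∀ (B : Type (max u v)) [Ring B] [Algebra (CyclotomicField n k) B] (y : Fin n → B) (s : B),
      CyclicSkew y s → ∀ ω : CyclotomicField n k, IsPrimitiveRoot ω n → ∀ c ∈ U,
        finFourier ω (fun i => y i ^ 2) (c : ℕ) ^ N = 0) :
    gkDim k A ≤ (n - U.card : ℕ) := by
  have hne : NeZero (n : k) := ⟨hn⟩
  have hK : (n : CyclotomicField n k) ≠ 0 := by
    rw [← map_natCast (algebraMap k (CyclotomicField n k))]
    exact (_root_.map_ne_zero _).2 hn
  have hω := IsCyclotomicExtension.zeta_spec n k (CyclotomicField n k)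
  set ι : A →ₐ[k] CyclotomicField n k ⊗[k] A := Algebra.TensorProduct.includeRight with hι
  have hB := h.map (ι : A →+* CyclotomicField n k ⊗[k] A)
  obtain ⟨C, hC⟩ := hB.finrank_pow_span_le hω hK U N (hU _ _ _ hB _ hω)
  have hfin : (insert 1 (insert g (Set.range x))).Finite :=
    ((Set.finite_range x).insert g).insert 1
  refine gkDim_le_of_growth C _ (Submodule.fg_span hfin) ?_ ?_ fun m =>
    (finrank_pow_span_le_tensorProduct k (CyclotomicField n k) _ hfin m).trans ?_
  · rw [Submodule.one_eq_span]
    exact Submodule.span_mono (by simp)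
  · rw [eq_top_iff, ← hadj]
    exact Algebra.adjoin_mono ((Set.subset_insert _ _).trans Submodule.subset_span)
  · rw [Set.image_insert_eq, Set.image_insert_eq, ← Set.range_comp, map_one]
    exact hC m

theorem gkDim_le_sub_totient (h : CyclicSkew x g) (hn : (n : k) ≠ 0)
    (hadj : Algebra.adjoin k (insert g (Set.range x)) = ⊤) :
    gkDim k A ≤ (n - n.totient : ℕ) := by
  have hK : (n : CyclotomicField n k) ≠ 0 := by
    rw [← map_natCast (algebraMap k (CyclotomicField n k))]
    exact (_root_.map_ne_zero _).2 hn
  have hcard : (Finset.univ.filter fun c : Fin n => (c : ℕ).Coprime n).card = n.totient := by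
    rw [Nat.totient_eq_card_coprime]
    refine Finset.card_bij (fun c _ => (c : ℕ)) (fun c hc => ?_) (fun c _ c' _ h => Fin.ext h)
      fun a ha => ?_
    · simpa [Nat.coprime_comm] using hc
    · rw [Finset.mem_filter, Finset.mem_range] at ha
      exact ⟨⟨a, ha.1⟩, by simpa using ha.2.symm, rfl⟩
  rw [← hcard]
  refine h.gkDim_le_sub_card hn hadj _ n fun B _ _ y s hy ω hω c hc => ?_
  exact hy.finFourier_sq_pow_eq_zero hω hK (Finset.mem_filter.1 hc).2

theorem gkDim_le_zero_of_two_pow (h : CyclicSkew x g) (hn : (n : k) ≠ 0) (h2 : (2 : k) ≠ 0)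
    (hadj : Algebra.adjoin k (insert g (Set.range x)) = ⊤) {d : ℕ} (hd : n = 2 ^ d) :
    gkDim k A ≤ 0 := by
  have hK : (n : CyclotomicField n k) ≠ 0 := by
    rw [← map_natCast (algebraMap k (CyclotomicField n k))]
    exact (_root_.map_ne_zero _).2 hn
  have h2K : (2 : CyclotomicField n k) ≠ 0 := by
    rw [← map_ofNat (algebraMap k (CyclotomicField n k))]
    exact (_root_.map_ne_zero _).2 h2
  have := h.gkDim_le_sub_card hn hadj Finset.univ (d + 1) fun B _ _ y s hy ω hω c _ =>
    hy.finFourier_sq_pow_eq_zero_of_two_pow hω hK h2K hd c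
  simpa using this

end CyclicSkew

/-! ### The smash product modulo its integral -/

section SmashProduct

variable (k : Type u) (A : Type v) (G : Type w) [Field k] [Ring A] [Algebra k A]
  [Group G] [MulSemiringAction G A] [SMulCommClass G k A]

/-- The quotient of the smash product by the ideal generated by the integral. -/
abbrev SmashQuotient [Finite G] : Type max v w :=
  (TwoSidedIdeal.span {smashIntegral k A G}).ringCon.Quotient

/-- The quotient map from the smash product. -/
def toSmashQuotient [Finite G] : SkewMonoidAlgebra A G →ₐ[k] SmashQuotient k A G :=
  RingCon.mkₐ k _

theorem toSmashQuotient_surjective [Finite G] : Function.Surjective (toSmashQuotient k A G) :=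
  RingCon.mkₐ_surjective (α := k) _

theorem toSmashQuotient_smashIntegral [Finite G] :
    toSmashQuotient k A G (smashIntegral k A G) = 0 := by
  refine (RingCon.eq _).2 ?_
  exact (TwoSidedIdeal.mem_iff _ _).1 (TwoSidedIdeal.subset_span rfl)

theorem nontrivial_quotient_span {S : Type v} {K : Type w} [Ring S] [Field K] (θ : S →+* K) {e : S}
    (h : θ e = 0) : Nontrivial (TwoSidedIdeal.span {e}).ringCon.Quotient := by
  have hle : TwoSidedIdeal.span {e} ≤ TwoSidedIdeal.ker θ := by
    rw [TwoSidedIdeal.span_le]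
    rintro _ rfl
    exact (TwoSidedIdeal.mem_ker θ).2 h
  refine ⟨1, 0, fun h => ?_⟩
  have h1 : (1 : S) ∈ TwoSidedIdeal.span {e} :=
    (TwoSidedIdeal.mem_iff _ _).2 ((RingCon.eq _).1 h)
  have h2 := (TwoSidedIdeal.mem_ker θ).1 (hle h1)
  rw [map_one] at h2
  exact one_ne_zero h2

/-- The coefficient ring inside the smash product. -/
def toSmash : A →ₐ[k] SkewMonoidAlgebra A G where
  toFun r := SkewMonoidAlgebra.single 1 r
  map_one' := rfl
  map_mul' a b := by simp [SkewMonoidAlgebra.single_mul_single]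
  map_zero' := by simp
  map_add' := by simp [SkewMonoidAlgebra.single_add]
  commutes' r := by simp [SkewMonoidAlgebra.coe_algebraMap]

variable {A G}

theorem toSmash_mul_single (r : A) (w : G) (s : A) :
    toSmash k A G r * SkewMonoidAlgebra.single w s = SkewMonoidAlgebra.single w (r * s) := by
  change SkewMonoidAlgebra.single 1 r * SkewMonoidAlgebra.single w s = _
  rw [SkewMonoidAlgebra.single_mul_single, one_mul, one_smul]

theorem single_mul_toSmash (w : G) (r : A) :
    SkewMonoidAlgebra.single w 1 * toSmash k A G r =
      toSmash k A G (w • r) * SkewMonoidAlgebra.single w 1 := by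
  rw [toSmash_mul_single]
  change SkewMonoidAlgebra.single w 1 * SkewMonoidAlgebra.single 1 r = _
  rw [SkewMonoidAlgebra.single_mul_single, mul_one, one_mul, mul_one]

theorem single_one_pow (w : G) (j : ℕ) :
    (SkewMonoidAlgebra.single w (1 : A)) ^ j = SkewMonoidAlgebra.single (w ^ j) 1 := by
  induction j with
  | zero => rw [pow_zero, pow_zero]; rfl
  | succ j ih => rw [pow_succ, ih, SkewMonoidAlgebra.single_mul_single, pow_succ, smul_one, mul_one]

theorem exists_pow_eq_of_forall_mem_zpowers [Finite G] {n : ℕ} {σ : G} (hσ : ∀ w, w ∈ Subgroup.zpowers σ)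
    (hn : orderOf σ = n) (w : G) : ∃ j < n, σ ^ j = w := by
  classical
  have h := (isOfFinOrder_of_finite σ).mem_zpowers_iff_mem_range_orderOf.1 (hσ w)
  simpa [hn] using h

theorem finsum_eq_sum_pow [Finite G] {n : ℕ} {σ : G} (hσ : ∀ w, w ∈ Subgroup.zpowers σ) (hn : orderOf σ = n)
    {M : Type u} [AddCommMonoid M] (f : G → M) :
    ∑ᶠ w, f w = ∑ j : Fin n, f (σ ^ (j : ℕ)) := by
  have hbij : Function.Bijective fun j : Fin n => σ ^ (j : ℕ) := by
    constructor
    · intro i j hij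
      exact Fin.ext (pow_injOn_Iio_orderOf (by simp [hn]) (by simp [hn]) hij)
    · intro w
      obtain ⟨j, hj, rfl⟩ := exists_pow_eq_of_forall_mem_zpowers hσ hn w
      exact ⟨⟨j, hj⟩, rfl⟩
  rw [← finsum_comp_equiv (Equiv.ofBijective _ hbij), finsum_eq_sum_of_fintype]
  rfl

theorem smashIntegral_eq [Finite G] {n : ℕ} {σ : G} (hσ : ∀ w, w ∈ Subgroup.zpowers σ) (hn : orderOf σ = n) :
    smashIntegral k A G =
      (n : k)⁻¹ • ∑ j : Fin n, SkewMonoidAlgebra.single σ (1 : A) ^ (j : ℕ) := by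
  rw [smashIntegral, finsum_eq_sum_pow hσ hn, ← orderOf_eq_card_of_forall_mem_zpowers hσ, hn,
    Finset.smul_sum]
  refine Finset.sum_congr rfl fun j _ => ?_
  rw [single_one_pow, SkewMonoidAlgebra.smul_single, Algebra.smul_def, mul_one]

/-- The one relation not already present in the smash product is `∑ g ^ j = 0`: this sum is `n`
times the integral, which is killed. -/
theorem cyclicSkew_smashQuotient [Finite G] {n : ℕ} {σ : G} (hσ : ∀ w, w ∈ Subgroup.zpowers σ)
    (hn : orderOf σ = n) (hnk : (n : k) ≠ 0) {x : Fin n → A}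
    (hx : ∀ i j, i ≠ j → x i * x j = -(x j * x i)) (hrot : ∀ i, σ • x i = x (finRotate n i)) :
    CyclicSkew (fun i => toSmashQuotient k A G (toSmash k A G (x i)))
      (toSmashQuotient k A G (SkewMonoidAlgebra.single σ 1)) where
  anticomm i j h := by rw [← map_mul, ← map_mul, hx i j h]; simp only [map_neg, map_mul]
  rotate i := by rw [← map_mul, ← map_mul, single_mul_toSmash, hrot]
  pow_eq_one := by
    rw [← map_pow, single_one_pow, ← hn, pow_orderOf_eq_one]
    exact map_one _
  sum_pow := by
    have h : ∑ j : Fin n, SkewMonoidAlgebra.single σ (1 : A) ^ (j : ℕ) =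
        algebraMap k (SkewMonoidAlgebra A G) n * smashIntegral k A G := by
      rw [smashIntegral_eq k hσ hn, ← Algebra.smul_def, smul_inv_smul₀ hnk]
    simp only [← map_pow, ← map_sum]
    rw [h, map_mul, toSmashQuotient_smashIntegral, mul_zero]

theorem adjoin_smashQuotient [Finite G] {n : ℕ} {σ : G} (hσ : ∀ w, w ∈ Subgroup.zpowers σ)
    (hn : orderOf σ = n) {x : Fin n → A} (hx : Algebra.adjoin k (Set.range x) = ⊤) :
    Algebra.adjoin k (insert (toSmashQuotient k A G (SkewMonoidAlgebra.single σ 1))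
      (Set.range fun i => toSmashQuotient k A G (toSmash k A G (x i)))) = ⊤ := by
  set T := Algebra.adjoin k (insert (toSmashQuotient k A G (SkewMonoidAlgebra.single σ 1))
      (Set.range fun i => toSmashQuotient k A G (toSmash k A G (x i)))) with hT
  have h1 : ∀ r, toSmashQuotient k A G (toSmash k A G r) ∈ T := by
    have : (⊤ : Subalgebra k A) ≤ T.comap ((toSmashQuotient k A G).comp (toSmash k A G)) := by
      rw [← hx, Algebra.adjoin_le_iff]
      rintro _ ⟨i, rfl⟩
      exact Algebra.subset_adjoin (Or.inr ⟨i, rfl⟩)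
    exact fun r => this Algebra.mem_top
  have hg : toSmashQuotient k A G (SkewMonoidAlgebra.single σ 1) ∈ T :=
    Algebra.subset_adjoin (Or.inl rfl)
  have h2 : ∀ w : G, toSmashQuotient k A G (SkewMonoidAlgebra.single w 1) ∈ T := by
    intro w
    obtain ⟨j, -, rfl⟩ := exists_pow_eq_of_forall_mem_zpowers hσ hn w
    rw [← single_one_pow, map_pow]
    exact pow_mem hg j
  rw [eq_top_iff]
  rintro b -
  obtain ⟨s, rfl⟩ := toSmashQuotient_surjective k A G b
  induction s using SkewMonoidAlgebra.induction_on' with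
  | single w r =>
    rw [← mul_one r, ← toSmash_mul_single k, map_mul]
    exact mul_mem (h1 r) (h2 w)
  | add a b ha hb => rw [map_add]; exact add_mem ha hb

/-- An invariant augmentation `ε` and the character `σ ↦ ω` combine to a ring map `r # w ↦ ε r * χ
w` into a field. It kills the integral because the powers of `ω ≠ 1` sum to zero. -/
theorem nontrivial_smashQuotient [Finite G] {n : ℕ} (hn2 : 2 ≤ n) {σ : G}
    (hσ : ∀ w, w ∈ Subgroup.zpowers σ) (hn : orderOf σ = n) {K : Type u} [Field K] [Algebra k K]
    {ω : K} (hω : IsPrimitiveRoot ω n) (ε : A →ₐ[k] K) (hε : ∀ (w : G) r, ε (w • r) = ε r) :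
    Nontrivial (SmashQuotient k A G) := by
  have hω0 : ω ≠ 0 := hω.ne_zero (by omega)
  let χ : G →* Kˣ := monoidHomOfForallMemZpowers (g := σ) (g' := Units.mk0 ω hω0) hσ (by
    rw [hn]
    exact orderOf_dvd_of_pow_eq_one (Units.ext hω.pow_eq_one))
  have hχ : χ σ = Units.mk0 ω hω0 := monoidHomOfForallMemZpowers_apply_gen _ _
  let θ : SkewMonoidAlgebra A G →ₐ[k] K :=
    SkewMonoidAlgebra.liftNCAlgHom ε ((Units.coeHom K).comp χ) fun {r w} => by
      rw [hε, mul_comm]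
  have h1 : θ (SkewMonoidAlgebra.single σ 1) = ω := by
    refine (SkewMonoidAlgebra.liftNC_single _ _ _ _).trans ?_
    simp [hχ]
  refine nontrivial_quotient_span (θ : SkewMonoidAlgebra A G →+* K) ?_
  change θ _ = 0
  rw [smashIntegral_eq k hσ hn, map_smul, map_sum]
  simp only [map_pow, h1]
  rw [Fin.sum_univ_eq_sum_range fun j => ω ^ j, hω.geom_sum_eq_zero (by omega), smul_zero]

end SmashProduct

/-! ### Pertinency of the cyclic action -/

namespace SkewPoly

variable (k : Type u) [Field k] (n : ℕ)

/-- The cyclic automorphism `x_1 ↦ x_2 ↦ ⋯ ↦ x_n ↦ x_1`. -/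
def rotation : W k n := ⟨permAut k n (finRotate n), Subgroup.mem_zpowers _⟩

theorem rotation_smul_x (i : Fin n) : rotation k n • x k n i = x k n (finRotate n i) :=
  permAut_apply k n _ _ |>.trans (permHom_x k _ _)

theorem mem_zpowers_rotation (w : W k n) : w ∈ Subgroup.zpowers (rotation k n) := by
  obtain ⟨w, j, rfl⟩ := w
  exact ⟨j, rfl⟩

theorem orderOf_finRotate [NeZero n] : orderOf (finRotate n) = n := by
  obtain ⟨n, rfl⟩ := Nat.exists_eq_succ_of_ne_zero (NeZero.ne n)
  rcases n with _ | n
  · simp [Subsingleton.elim (finRotate 1) 1]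
  · rw [isCycle_finRotate.orderOf, support_finRotate, Finset.card_univ, Fintype.card_fin]

theorem orderOf_rotation [NeZero n] : orderOf (rotation k n) = n := by
  rw [← Subgroup.orderOf_coe]
  change orderOf (permAut k n (finRotate n)) = n
  rw [orderOf_injective _ (permAut_injective k n), orderOf_finRotate]

/-- The augmentation `x_i ↦ 0`. -/
def augmentation (K : Type v) [Field K] [Algebra k K] : SkewPoly k n →ₐ[k] K :=
  RingQuot.liftAlgHom k ⟨FreeAlgebra.lift k fun _ => (0 : K), by
    rintro _ _ ⟨i, j, h⟩
    simp⟩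

theorem augmentation_x (K : Type v) [Field K] [Algebra k K] (i : Fin n) :
    augmentation k n K (x k n i) = 0 := by
  simp [augmentation, x]

theorem augmentation_smul (K : Type v) [Field K] [Algebra k K] (w : W k n) (r : SkewPoly k n) :
    augmentation k n K (w • r) = augmentation k n K r := by
  obtain ⟨_, j, rfl⟩ := w
  have h : (augmentation k n K).comp (permHom k n (finRotate n ^ j)) = augmentation k n K :=
    algHom_ext fun i => by simp [augmentation_x]
  have h2 := DFunLike.congr_fun h r
  rw [← h2]
  change augmentation k n K (((permAut k n (finRotate n) ^ j : gradedAut (grading k n)) :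
    SkewPoly k n ≃ₐ[k] SkewPoly k n) r) = _
  rw [← map_zpow, permAut_apply]
  rfl

theorem totient_le_pertinency [NeZero n] (hn : (n : k) ≠ 0) :
    ((n.totient : ℝ) : EReal) ≤ pertinency k (SkewPoly k n) (W k n) := by
  have h := (cyclicSkew_smashQuotient k (mem_zpowers_rotation k n) (orderOf_rotation k n) hn
    (fun _ _ => x_mul_x) (rotation_smul_x k n)).gkDim_le_sub_totient hn
      (adjoin_smashQuotient k (mem_zpowers_rotation k n) (orderOf_rotation k n)
        (adjoin_range_x k n))
  rw [pertinency, gkDim_eq]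
  refine le_trans ?_ (EReal.sub_le_sub le_rfl h)
  have h1 : (n : EReal) = ((n : ℝ) : EReal) := by simp
  have h2 : ((n - n.totient : ℕ) : EReal) = (((n - n.totient : ℕ) : ℝ) : EReal) := by simp
  rw [h1, h2, ← EReal.coe_sub, Nat.cast_sub (Nat.totient_le n)]
  simp

theorem pertinency_eq_of_two_pow (hn2 : 2 ≤ n) (hn : (n : k) ≠ 0) (h2 : (2 : k) ≠ 0) {d : ℕ}
    (hd : n = 2 ^ d) : pertinency k (SkewPoly k n) (W k n) = n := by
  have : NeZero n := ⟨by omega⟩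
  have : NeZero (n : k) := ⟨hn⟩
  -- This rules out the value `-∞`, so that the bound `GKdim ≤ 0` becomes an equality.
  have := nontrivial_smashQuotient k hn2 (mem_zpowers_rotation k n) (orderOf_rotation k n)
    (IsCyclotomicExtension.zeta_spec n k (CyclotomicField n k))
    (augmentation k n (CyclotomicField n k)) (augmentation_smul k n _)
  have h := (cyclicSkew_smashQuotient k (mem_zpowers_rotation k n) (orderOf_rotation k n) hn
    (fun _ _ => x_mul_x) (rotation_smul_x k n)).gkDim_le_zero_of_two_pow hn h2
      (adjoin_smashQuotient k (mem_zpowers_rotation k n) (orderOf_rotation k n)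
        (adjoin_range_x k n)) hd
  rw [pertinency, gkDim_eq, le_antisymm h gkDim_nonneg, sub_zero]

end SkewPoly

/-! ### Signed action on monomials and the trace series -/

theorem commute_neg_one_pow {B : Type v} [Ring B] (b : B) (j : ℕ) : Commute b ((-1) ^ j) :=
  ((Commute.one_right b).neg_right).pow_right j

theorem eq_mul_of_neg_eq_mul_neg {B : Type v} [Ring B] {a b c : B} (h : -a = c * -b) :
    a = c * b := by
  rw [mul_neg] at h
  exact neg_injective h

theorem List.prod_map_mul_of_anticomm {B : Type v} [Ring B] {ι : Type w} {v : ι → B}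
    (hv : ∀ i j, i ≠ j → v i * v j = -(v j * v i)) (a : ι) (l : List ι) (ha : a ∉ l) :
    (l.map v).prod * v a = (-1) ^ l.length * (v a * (l.map v).prod) := by
  induction l with
  | nil => simp
  | cons b l ih =>
    simp only [List.mem_cons, not_or] at ha
    rw [List.map_cons, List.prod_cons, mul_assoc, ih ha.2, List.length_cons, pow_succ',
      ← mul_assoc (v a), hv a b ha.1, ← mul_assoc, (commute_neg_one_pow (v b) l.length).eq]
    simp only [mul_assoc, neg_mul, one_mul, mul_neg, neg_neg]

namespace SkewPoly

variable (k : Type u) [Field k] (n : ℕ)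

theorem grading_eq_span (i : ℕ) : grading k n i =
    Submodule.span k (Set.range fun μ : Sym (Fin n) i => multisetWord (x k n) μ) := by
  refine le_antisymm ?_ (Submodule.span_le.2 ?_)
  · induction i with
    | zero =>
      rw [grading, pow_zero, Submodule.one_eq_span]
      refine Submodule.span_mono ?_
      rintro _ rfl
      exact ⟨Sym.nil, by simp [multisetWord]⟩
    | succ i ih =>
      rw [grading, pow_succ']
      refine (mul_le_mul_right ih _).trans ?_
      rw [Submodule.span_mul_span, Submodule.span_le]
      rintro _ ⟨_, ⟨a, rfl⟩, _, ⟨μ, rfl⟩, rfl⟩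
      have hmem : multisetWord (x k n) (a ::ₘ μ) ∈ Submodule.span k
          (Set.range fun μ : Sym (Fin n) (i + 1) => multisetWord (x k n) μ) :=
        Submodule.subset_span ⟨a ::ₛ μ, rfl⟩
      rcases (signCommute_x k n).mul_multisetWord a μ with h | h
      · simpa [h] using hmem
      · simpa [h] using hmem
  · rintro _ ⟨μ, rfl⟩
    have := multisetWord_mem_pow_card k n (μ : Multiset (Fin n))
    rwa [Sym.card_coe] at this

/-- The monomial basis of a homogeneous component. -/
def gradingBasis (i : ℕ) : Module.Basis (Sym (Fin n) i) k (grading k n i) :=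
  (Module.Basis.span ((linearIndependent_multisetWord k n).comp
    (fun μ : Sym (Fin n) i => (μ : Multiset (Fin n))) Sym.coe_injective)).map
    (LinearEquiv.ofEq _ _ (grading_eq_span k n i).symm)

theorem coe_gradingBasis (i : ℕ) (μ : Sym (Fin n) i) :
    (gradingBasis k n i μ : SkewPoly k n) = multisetWord (x k n) μ := by
  rw [gradingBasis, Module.Basis.map_apply, LinearEquiv.coe_ofEq_apply, Module.Basis.span_apply]
  rfl

theorem permHom_prod (s : Equiv.Perm (Fin n)) (l : List (Fin n)) :
    permHom k n s (l.map (x k n)).prod = ((l.map s).map (x k n)).prod := by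
  rw [map_list_prod]
  simp [Function.comp_def]

theorem permHom_multisetWord (s : Equiv.Perm (Fin n)) (μ : Multiset (Fin n)) :
    permHom k n s (multisetWord (x k n) μ) = multisetWord (x k n) (μ.map s) ∨
      permHom k n s (multisetWord (x k n) μ) = -multisetWord (x k n) (μ.map s) := by
  rw [multisetWord, permHom_prod]
  have := (signCommute_x k n).prod_eq_multisetWord (μ.toList.map s)
  rwa [← Multiset.map_coe, Multiset.coe_toList] at this

/-- All cycles of the permutation have length `m`. -/
def FreeOfOrder {n : ℕ} (s : Equiv.Perm (Fin n)) (m : ℕ) : Prop :=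
  s ^ m = 1 ∧ 0 < m ∧ ∀ i (a : ℕ), (s ^ a) i = i → m ∣ a

variable {n} {s : Equiv.Perm (Fin n)} {m : ℕ}

theorem FreeOfOrder.injOn (hs : FreeOfOrder s m) (i : Fin n) :
    Set.InjOn (fun a : ℕ => (s ^ a) i) (Set.Iio m) := by
  have key : ∀ a b, a ≤ b → b < m → (s ^ a) i = (s ^ b) i → a = b := by
    intro a b hab hb h
    obtain ⟨c, rfl⟩ := Nat.exists_eq_add_of_le hab
    rw [pow_add, Equiv.Perm.mul_apply, EmbeddingLike.apply_eq_iff_eq] at h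
    have := hs.2.2 i c h.symm
    have := Nat.eq_zero_of_dvd_of_lt this (by omega)
    omega
  intro a ha b hb h
  rcases le_total a b with hab | hab
  · exact key a b hab hb h
  · exact (key b a hab ha h.symm).symm

/-- The cycle of `i`, as a list. -/
def cycleList (s : Equiv.Perm (Fin n)) (m : ℕ) (i : Fin n) : List (Fin n) :=
  (List.range m).map fun a => (s ^ a) i

theorem FreeOfOrder.nodup_cycleList (hs : FreeOfOrder s m) (i : Fin n) :
    (cycleList s m i).Nodup :=
  List.nodup_range.map_on fun _ ha _ hb h =>
    hs.injOn i (by simpa using ha) (by simpa using hb) h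

/-- The product along a cycle is rotated by one place; bringing the last factor `x i` back to the
front passes `m - 1` distinct generators. -/
theorem FreeOfOrder.permHom_cycleList (hs : FreeOfOrder s m) (i : Fin n) :
    permHom k n s ((cycleList s m i).map (x k n)).prod =
      (-1) ^ (m - 1) * ((cycleList s m i).map (x k n)).prod := by
  obtain ⟨m, rfl⟩ := Nat.exists_eq_succ_of_ne_zero hs.2.1.ne'
  have hcons : cycleList s (m + 1) i = i :: (List.range m).map fun a => (s ^ (a + 1)) i := by
    simp [cycleList, List.range_succ_eq_map, Function.comp_def]
  have hnd := hs.nodup_cycleList i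
  have hmap : (cycleList s (m + 1) i).map s =
      ((List.range m).map fun a => (s ^ (a + 1)) i) ++ [i] := by
    have hlast : s ((s ^ m) i) = i := by
      rw [← Equiv.Perm.mul_apply, ← pow_succ', hs.1]
      rfl
    simp [cycleList, List.range_succ, Function.comp_def, pow_succ', hlast]
  rw [Nat.succ_eq_add_one, hcons] at hnd
  rw [permHom_prod, Nat.succ_eq_add_one, hmap, hcons]
  have := List.prod_map_mul_of_anticomm (v := x k n) (fun _ _ h => x_mul_x h) i _ (List.nodup_cons.1 hnd).1
  simpa using this

theorem FreeOfOrder.cycleList_le (hs : FreeOfOrder s m) {μ : Multiset (Fin n)}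
    (hμ : μ.map s = μ) {i : Fin n} (hi : i ∈ μ) : (cycleList s m i : Multiset (Fin n)) ≤ μ := by
  rw [Multiset.le_iff_subset (by simpa using hs.nodup_cycleList i)]
  intro j hj
  simp only [cycleList, Multiset.mem_coe, List.mem_map, List.mem_range] at hj
  obtain ⟨a, -, rfl⟩ := hj
  induction a with
  | zero => simpa using hi
  | succ a ih =>
    rw [← hμ, pow_succ']
    exact Multiset.mem_map_of_mem s ih

theorem FreeOfOrder.map_cycleList (hs : FreeOfOrder s m) (i : Fin n) :
    (cycleList s m i : Multiset (Fin n)).map s = cycleList s m i := by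
  obtain ⟨m, rfl⟩ := Nat.exists_eq_succ_of_ne_zero hs.2.1.ne'
  have hlast : s ((s ^ m) i) = i := by
    rw [← Equiv.Perm.mul_apply, ← pow_succ', hs.1]
    rfl
  rw [Multiset.map_coe, Multiset.coe_eq_coe]
  have h1 : (cycleList s (m + 1) i).map s =
      ((List.range m).map fun a => (s ^ (a + 1)) i) ++ [i] := by
    simp [cycleList, List.range_succ, Function.comp_def, pow_succ', hlast]
  have h2 : cycleList s (m + 1) i = i :: (List.range m).map fun a => (s ^ (a + 1)) i := by
    simp [cycleList, List.range_succ_eq_map, Function.comp_def]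
  rw [Nat.succ_eq_add_one, h1, h2]
  exact List.perm_append_singleton _ _

/-- An invariant multiset is a sum of `μ.card / m` full cycles. They are stripped off one at a time,
each giving `(-1) ^ (m - 1)`. -/
theorem FreeOfOrder.permHom_multisetWord (hs : FreeOfOrder s m) (μ : Multiset (Fin n))
    (hμ : μ.map s = μ) : permHom k n s (multisetWord (x k n) μ) =
      (-1) ^ ((m - 1) * (μ.card / m)) * multisetWord (x k n) μ := by
  induction hc : μ.card using Nat.strong_induction_on generalizing μ with
  | _ c ih =>
  rcases Multiset.empty_or_exists_mem μ with rfl | ⟨i, hi⟩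
  · simp [multisetWord, ← hc]
  have hle := hs.cycleList_le hμ hi
  obtain ⟨ν, hν⟩ := Multiset.le_iff_exists_add.1 hle
  have hνμ : ν.map s = ν := by
    rw [hν, Multiset.map_add, hs.map_cycleList] at hμ
    exact add_left_cancel hμ
  have hcard : c = m + ν.card := by
    rw [← hc, hν, Multiset.card_add]
    simp [cycleList]
  have ih := ih ν.card (by have := hs.2.1; omega) ν hνμ rfl
  have hw : permHom k n s
      (((cycleList s m i ++ ν.toList).map (x k n)).prod) =
        (-1) ^ ((m - 1) * (c / m)) * ((cycleList s m i ++ ν.toList).map (x k n)).prod := by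
    have hdiv : c / m = ν.card / m + 1 := by
      rw [hcard, Nat.add_div_left _ hs.2.1]
    have hcomm : Commute ((cycleList s m i).map (x k n)).prod
        ((-1 : SkewPoly k n) ^ ((m - 1) * (ν.card / m))) :=
      commute_neg_one_pow _ _
    rw [List.map_append, List.prod_append, map_mul, hs.permHom_cycleList k]
    change _ * permHom k n s (multisetWord (x k n) ν) = _
    rw [ih, hdiv, mul_add, mul_one, pow_add, mul_assoc, ← mul_assoc _ _ (multisetWord _ _),
      hcomm.eq, ← mul_assoc, ← mul_assoc, ← pow_add, ← pow_add, add_comm (m - 1)]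
    rw [mul_assoc]
    rfl
  -- Reordering the word changes both sides by the same sign, so the eigenvalue does not depend on
  -- the chosen order.
  have hp := (signCommute_x k n).prod_eq_multisetWord (cycleList s m i ++ ν.toList)
  rw [← Multiset.coe_add, Multiset.coe_toList, ← hν] at hp
  rcases hp with hp | hp
  · rwa [hp] at hw
  · rw [hp] at hw
    rw [map_neg] at hw
    exact eq_mul_of_neg_eq_mul_neg hw

/-- The matrix is a signed permutation matrix: only invariant monomials reach the diagonal, and in a
fixed degree they all carry the same sign. -/
theorem FreeOfOrder.coeff_traceSeries (hs : FreeOfOrder s m) (i : ℕ) :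
    PowerSeries.coeff i (traceSeries (grading k n) (permAut k n s)) =
      (Fintype.card {μ : Sym (Fin n) i // μ.map s = μ} : k) * (-1) ^ ((m - 1) * (i / m)) := by
  classical
  rw [traceSeries, PowerSeries.coeff_mk, LinearMap.trace_eq_matrix_trace k (gradingBasis k n i),
    Matrix.trace]
  have hdiag : ∀ μ : Sym (Fin n) i, (LinearMap.toMatrix (gradingBasis k n i) (gradingBasis k n i)
      ((permAut k n s : SkewPoly k n ≃ₐ[k] SkewPoly k n).toLinearMap.restrict
        (p := grading k n i) (q := grading k n i) fun _ hx =>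
          ((permAut k n s).2 i).le (Submodule.mem_map_of_mem hx))).diag μ =
        if μ.map s = μ then (-1) ^ ((m - 1) * (i / m)) else 0 := by
    intro μ
    rw [Matrix.diag_apply, LinearMap.toMatrix_apply]
    have hco : ((μ.map s : Sym (Fin n) i) : Multiset (Fin n)) = (μ : Multiset (Fin n)).map s := rfl
    split_ifs with h
    · have h1 := hs.permHom_multisetWord k (μ : Multiset (Fin n)) (by rw [← hco, h])
      rw [Sym.card_coe] at h1
      have h2 : LinearMap.restrict _ (fun _ hx =>
          ((permAut k n s).2 i).le (Submodule.mem_map_of_mem hx)) (gradingBasis k n i μ) =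
          ((-1 : k) ^ ((m - 1) * (i / m))) • gradingBasis k n i μ := by
        refine Subtype.ext ?_
        rw [LinearMap.coe_restrict_apply, Submodule.coe_smul, coe_gradingBasis]
        refine h1.trans ?_
        rw [Algebra.smul_def]
        simp
      rw [h2, map_smul, Module.Basis.repr_self]
      simp
    · have h1 := SkewPoly.permHom_multisetWord k n s (μ : Multiset (Fin n))
      rw [← hco, ← coe_gradingBasis, ← coe_gradingBasis] at h1
      have h2 : ∃ c : k, LinearMap.restrict _ (fun _ hx =>
          ((permAut k n s).2 i).le (Submodule.mem_map_of_mem hx)) (gradingBasis k n i μ) =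
          c • gradingBasis k n i (μ.map s) := by
        rcases h1 with h1 | h1
        · exact ⟨1, Subtype.ext (h1.trans (one_smul k _).symm)⟩
        · exact ⟨-1, Subtype.ext (h1.trans (neg_one_smul k _).symm)⟩
      obtain ⟨c, h2⟩ := h2
      rw [h2, map_smul, Module.Basis.repr_self]
      simp [h]
  rw [Finset.sum_congr rfl fun μ _ => hdiag μ, ← Finset.sum_filter, Finset.sum_const, nsmul_eq_mul,
    Fintype.card_subtype]

end SkewPoly

/-! ### Powers of geometric series and their poles -/

section GeometricPower

variable {k : Type u} [Field k]

/-- The series `∑ j, multichoose q j * ε ^ j * X ^ (m * j)`. -/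
def multichooseSeries (ε : k) (m q : ℕ) : k⟦X⟧ :=
  PowerSeries.mk fun i => if m ∣ i then (q.multichoose (i / m) : k) * ε ^ (i / m) else 0

theorem multichooseSeries_zero (ε : k) {m : ℕ} (hm : 0 < m) : multichooseSeries ε m 0 = 1 := by
  ext i
  rw [multichooseSeries, PowerSeries.coeff_mk, PowerSeries.coeff_one]
  split_ifs with h1 h2 h2
  · simp [h2]
  · obtain ⟨j, rfl⟩ := h1
    rw [Nat.mul_div_cancel_left _ hm]
    cases j with
    | zero => simp at h2
    | succ j => simp
  · simp [h2] at h1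
  · rfl

/-- This is the Pascal recurrence for `multichoose`; iterating it identifies the series with `(1 - ε
X ^ m) ^ (-q)`. -/
theorem mul_multichooseSeries_succ (ε : k) {m : ℕ} (hm : 0 < m) (q : ℕ) :
    (((1 - Polynomial.C ε * Polynomial.X ^ m : k[X]) : k⟦X⟧)) * multichooseSeries ε m (q + 1) =
      multichooseSeries ε m q := by
  ext i
  rw [Polynomial.coe_sub, Polynomial.coe_one, Polynomial.coe_mul, Polynomial.coe_C,
    Polynomial.coe_pow, Polynomial.coe_X, sub_mul, one_mul, map_sub, mul_assoc,
    PowerSeries.coeff_C_mul, PowerSeries.coeff_X_pow_mul']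
  simp only [multichooseSeries, PowerSeries.coeff_mk]
  by_cases h : m ∣ i
  · obtain ⟨j, rfl⟩ := h
    cases j with
    | zero => simp [hm.not_ge]
    | succ j =>
      have h1 : m ≤ m * (j + 1) := Nat.le_mul_of_pos_right m (Nat.succ_pos j)
      have h2 : m * (j + 1) - m = m * j := by rw [mul_add, mul_one, Nat.add_sub_cancel]
      rw [if_pos (dvd_mul_right _ _), if_pos h1, h2, if_pos (dvd_mul_right _ _),
        if_pos (dvd_mul_right _ _), Nat.mul_div_cancel_left _ hm, Nat.mul_div_cancel_left _ hm,
        Nat.multichoose_succ_succ]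
      push_cast
      ring
  · rw [if_neg h, if_neg h]
    split_ifs with h1 h2
    · exact absurd ((Nat.dvd_sub_iff_left h1 dvd_rfl).1 h2) h
    · simp
    · simp

theorem pow_mul_multichooseSeries (ε : k) {m : ℕ} (hm : 0 < m) (q : ℕ) :
    (((1 - Polynomial.C ε * Polynomial.X ^ m : k[X]) ^ q : k[X]) : k⟦X⟧) *
      multichooseSeries ε m q = 1 := by
  induction q with
  | zero => simp [multichooseSeries_zero ε hm]
  | succ q ih =>
    rw [pow_succ, Polynomial.coe_mul, mul_assoc, mul_multichooseSeries_succ ε hm, ih]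

theorem poleOrder_eq_zero {F : k⟦X⟧} {a : k} (Q : k[X]) (hQ : Q.eval a ≠ 0)
    (h : (Q : k⟦X⟧) * F = 1) : poleOrder F a = 0 := by
  refine le_antisymm (iInf₂_le_of_le 0 ⟨1, Q, hQ, by simpa using h⟩ (by simp)) ?_
  exact le_iInf₂ fun m _ => by positivity

/-- If a smaller power `b < q` cleared the pole with cofactor `R`, cancelling `(X - a) ^ b` would
leave `R` divisible by `X - a`, against `R.eval a ≠ 0`. -/
theorem poleOrder_eq {F : k⟦X⟧} {a : k} (q : ℕ) (Q : k[X]) (hQ : Q.eval a ≠ 0)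
    (h : (((Polynomial.X - Polynomial.C a) ^ q * Q : k[X]) : k⟦X⟧) * F = 1) :
    poleOrder F a = q := by
  refine le_antisymm (iInf₂_le_of_le q ⟨1, Q, hQ, by simpa using h⟩ le_rfl) ?_
  refine le_iInf₂ ?_
  rintro b ⟨P, R, hR, hb⟩
  have h1 : (Polynomial.X - Polynomial.C a) ^ b * R =
      P * ((Polynomial.X - Polynomial.C a) ^ q * Q) := by
    rw [← Polynomial.coe_inj, Polynomial.coe_mul P, ← hb, mul_assoc, mul_comm F, h, mul_one]
  by_contra hlt
  rw [not_le, Nat.cast_lt] at hlt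
  have h2 : R = P * ((Polynomial.X - Polynomial.C a) ^ (q - b) * Q) := by
    have hne : (Polynomial.X - Polynomial.C a) ^ b ≠ 0 :=
      pow_ne_zero _ (Polynomial.X_sub_C_ne_zero a)
    refine mul_left_cancel₀ hne ?_
    rw [h1, ← pow_mul_pow_sub _ hlt.le]
    ring
  apply hR
  rw [h2]
  simp [show q - b ≠ 0 by omega]

theorem poleOrder_one_multichooseSeries {m : ℕ} (hm : (m : k) ≠ 0) (q : ℕ) :
    poleOrder (multichooseSeries (1 : k) m q) 1 = q := by
  have hm0 : 0 < m := Nat.pos_of_ne_zero (by rintro rfl; simp at hm)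
  -- The cofactor comes from `1 - X ^ m = (X - 1) * (-∑ X ^ i)`; its base takes the value `-m ≠ 0`
  -- at `1`.
  refine poleOrder_eq q ((-∑ i ∈ Finset.range m, Polynomial.X ^ i) ^ q) ?_ ?_
  · simpa [Polynomial.eval_finsetSum] using fun h => absurd h hm
  · rw [← mul_pow]
    have : (Polynomial.X - Polynomial.C (1 : k)) * (-∑ i ∈ Finset.range m, Polynomial.X ^ i) =
        1 - Polynomial.C 1 * Polynomial.X ^ m := by
      rw [Polynomial.C_1, mul_neg, mul_geom_sum]
      ring
    rw [this]
    exact pow_mul_multichooseSeries 1 hm0 q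

/-- The denominator `1 + X ^ m` takes the value `2 ≠ 0` at `1`. -/
theorem poleOrder_neg_one_multichooseSeries (h2 : (2 : k) ≠ 0) {m : ℕ} (hm : 0 < m) (q : ℕ) :
    poleOrder (multichooseSeries (-1 : k) m q) 1 = 0 := by
  refine poleOrder_eq_zero _ ?_ (pow_mul_multichooseSeries (-1) hm q)
  simp only [Polynomial.eval_pow, Polynomial.eval_sub, Polynomial.eval_one, Polynomial.eval_mul,
    Polynomial.eval_C, Polynomial.eval_X, one_pow]
  refine pow_ne_zero _ ?_
  norm_num
  exact h2

end GeometricPower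

/-! ### Counting invariant monomials by cycles -/

namespace SkewPoly

variable {n : ℕ} {s : Equiv.Perm (Fin n)} {m : ℕ}

/-- The set of cycles of a permutation. -/
abbrev Cycles (s : Equiv.Perm (Fin n)) : Type :=
  Quotient (Equiv.Perm.SameCycle.setoid s)

instance (s : Equiv.Perm (Fin n)) : Fintype (Cycles s) := Fintype.ofFinite _

instance (s : Equiv.Perm (Fin n)) : DecidableEq (Cycles s) := Classical.decEq _

/-- The cycle containing a point. -/
def toCycle (s : Equiv.Perm (Fin n)) (i : Fin n) : Cycles s := Quotient.mk _ i

theorem toCycle_eq_iff {i j : Fin n} : toCycle s i = toCycle s j ↔ s.SameCycle i j :=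
  Quotient.eq

theorem FreeOfOrder.card_fiber (hs : FreeOfOrder s m) (c : Cycles s) :
    (Finset.univ.filter fun j => toCycle s j = c).card = m := by
  obtain ⟨i, rfl⟩ := Quotient.exists_rep c
  change (Finset.univ.filter fun j => toCycle s j = toCycle s i).card = m
  conv_rhs => rw [← Finset.card_range m]
  symm
  refine Finset.card_bij (fun a _ => (s ^ a) i) (fun a _ => ?_) (fun a ha b hb h => ?_)
    fun j hj => ?_
  · rw [Finset.mem_filter, toCycle_eq_iff]
    exact ⟨Finset.mem_univ _, Equiv.Perm.SameCycle.symm ⟨a, by simp⟩⟩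
  · exact hs.injOn i (by simpa using ha) (by simpa using hb) h
  · rw [Finset.mem_filter, toCycle_eq_iff] at hj
    obtain ⟨z, hz⟩ := hj.2.symm
    have hm : (0 : ℤ) < m := by exact_mod_cast hs.2.1
    obtain ⟨a, ha⟩ := Int.eq_ofNat_of_zero_le (Int.emod_nonneg z hm.ne')
    refine ⟨a, ?_, ?_⟩
    · have := Int.emod_lt_of_pos z hm
      rw [Finset.mem_range]
      omega
    · rw [← hz, ← Int.emod_add_mul_ediv z m, ha, zpow_add, zpow_mul]
      simp [hs.1]

theorem FreeOfOrder.card_cycles_mul (hs : FreeOfOrder s m) : Fintype.card (Cycles s) * m = n := by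
  have h := Finset.card_eq_sum_card_fiberwise (s := (Finset.univ : Finset (Fin n)))
    (t := (Finset.univ : Finset (Cycles s))) (f := toCycle s) (fun _ _ => Finset.mem_univ _)
  rw [Finset.sum_congr rfl fun c _ => hs.card_fiber c] at h
  simpa using h.symm

theorem FreeOfOrder.sum_toCycle (hs : FreeOfOrder s m) (P : Cycles s → ℕ) :
    ∑ j, P (toCycle s j) = m * ∑ c, P c := by
  rw [← Finset.sum_fiberwise Finset.univ (toCycle s), Finset.mul_sum]
  refine Finset.sum_congr rfl fun c _ => ?_
  rw [Finset.sum_congr rfl fun j hj => by rw [(Finset.mem_filter.1 hj).2], Finset.sum_const,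
    hs.card_fiber, smul_eq_mul]

theorem count_eq_of_sameCycle {μ : Multiset (Fin n)} (hμ : μ.map s = μ) {i j : Fin n}
    (h : s.SameCycle i j) : μ.count i = μ.count j := by
  obtain ⟨a, -, rfl⟩ := h.exists_pow_eq'
  have hpow : ∀ a : ℕ, μ.map (s ^ a : Equiv.Perm (Fin n)) = μ := fun a => by
    induction a with
    | zero => simp
    | succ a ih =>
      rw [pow_succ, Equiv.Perm.coe_mul, ← Multiset.map_map, hμ, ih]
  conv_rhs => rw [← hpow a]
  rw [Multiset.count_map_eq_count' _ _ (Equiv.injective _)]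

/-- Invariant multisets are those whose multiplicity is constant on cycles, hence functions `P` on
the set of cycles with `m * ∑ P = i`. -/
theorem FreeOfOrder.card_fixed (hs : FreeOfOrder s m) (i : ℕ) :
    Fintype.card {μ : Sym (Fin n) i // μ.map s = μ} =
      if m ∣ i then (Fintype.card (Cycles s)).multichoose (i / m) else 0 := by
  let f : {P : Cycles s → ℕ // m * ∑ c, P c = i} → {μ : Sym (Fin n) i // μ.map s = μ} := fun P =>
    ⟨⟨∑ j, P.1 (toCycle s j) • {j}, by
      rw [Multiset.card_sum]
      refine Eq.trans ?_ ((hs.sum_toCycle P.1).trans P.2)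
      simp⟩, by
      refine Subtype.ext ?_
      change Multiset.map s (∑ j, P.1 (toCycle s j) • {j}) = ∑ j, P.1 (toCycle s j) • {j}
      rw [← Multiset.coe_mapAddMonoidHom, map_sum, ← Equiv.sum_comp s fun j =>
        P.1 (toCycle s j) • ({j} : Multiset (Fin n))]
      refine Finset.sum_congr rfl fun j _ => ?_
      have : toCycle s (s j) = toCycle s j :=
        toCycle_eq_iff.2 (Equiv.Perm.sameCycle_apply_left.2 (Equiv.Perm.SameCycle.refl s j))
      rw [map_nsmul, this]
      simp⟩
  have hcount : ∀ P j, ((f P).1 : Multiset (Fin n)).count j = P.1 (toCycle s j) := by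
    intro P j
    change Multiset.count j (∑ j, P.1 (toCycle s j) • {j}) = _
    simp [Multiset.count_sum', Multiset.count_singleton]
  have hf : Function.Bijective f := by
    constructor
    · intro P P' h
      refine Subtype.ext (funext fun c => ?_)
      obtain ⟨j, rfl⟩ := Quotient.exists_rep c
      exact (hcount P j).symm.trans ((congrArg (fun μ => (μ.1 : Multiset (Fin n)).count j) h).trans
        (hcount P' j))
    · intro μ
      have hμ : (μ.1 : Multiset (Fin n)).map s = μ.1 := congrArg Subtype.val μ.2
      have hP : ∀ j, (μ.1 : Multiset (Fin n)).count (toCycle s j).out =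
          (μ.1 : Multiset (Fin n)).count j := fun j =>
        count_eq_of_sameCycle hμ (toCycle_eq_iff.1 (Quotient.out_eq _))
      refine ⟨⟨fun c => (μ.1 : Multiset (Fin n)).count c.out, ?_⟩, ?_⟩
      · rw [← hs.sum_toCycle, Finset.sum_congr rfl fun j _ => hP j,
          Multiset.sum_count_eq_card fun j _ => Finset.mem_univ j]
        exact Sym.card_coe
      · refine Subtype.ext (Subtype.ext (Multiset.ext.2 fun j => ?_))
        exact (hcount _ j).trans (hP j)
  rw [← Nat.card_eq_fintype_card, ← Nat.card_congr (Equiv.ofBijective f hf)]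
  split_ifs with h
  · obtain ⟨j, rfl⟩ := h
    rw [Nat.mul_div_cancel_left _ hs.2.1, ← Sym.card_sym_eq_multichoose,
      ← Nat.card_eq_fintype_card, Nat.card_congr (Sym.equivNatSumOfFintype (Cycles s) j)]
    refine Nat.card_congr (Equiv.subtypeEquivRight fun P => ?_)
    exact Nat.mul_right_inj hs.2.1.ne'
  · have : IsEmpty {P : Cycles s → ℕ // m * ∑ c, P c = i} :=
      ⟨fun P => h ⟨_, P.2.symm⟩⟩
    simp

theorem FreeOfOrder.traceSeries_eq (k : Type u) [Field k] (hs : FreeOfOrder s m) :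
    traceSeries (grading k n) (permAut k n s) =
      multichooseSeries ((-1) ^ (m - 1)) m (Fintype.card (Cycles s)) := by
  ext i
  rw [hs.coeff_traceSeries k, hs.card_fixed, multichooseSeries, PowerSeries.coeff_mk]
  split_ifs <;> simp [pow_mul]

theorem FreeOfOrder.autReflectionNumber_eq_of_even (k : Type u) [Field k] (hs : FreeOfOrder s m)
    (h2 : (2 : k) ≠ 0) (hm : Even m) :
    autReflectionNumber (grading k n) (permAut k n s) = n := by
  have hodd : Odd (m - 1) := Nat.Even.sub_odd hs.2.1 hm odd_one
  rw [autReflectionNumber, gkDim_eq, hs.traceSeries_eq k, hodd.neg_one_pow,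
    poleOrder_neg_one_multichooseSeries h2 hs.2.1, sub_zero]

theorem FreeOfOrder.autReflectionNumber_eq_of_odd (k : Type u) [Field k] (hs : FreeOfOrder s m)
    (hmk : (m : k) ≠ 0) (hm : Odd m) :
    autReflectionNumber (grading k n) (permAut k n s) =
      (((n : ℝ) * (1 - 1 / (m : ℝ)) : ℝ) : EReal) := by
  have heven : Even (m - 1) := Nat.Odd.sub_odd hm odd_one
  have hm0 : (m : ℝ) ≠ 0 := by exact_mod_cast hs.2.1.ne'
  rw [autReflectionNumber, gkDim_eq, hs.traceSeries_eq k, heven.neg_one_pow,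
    poleOrder_one_multichooseSeries hmk]
  have h1 : (n : EReal) = ((n : ℝ) : EReal) := by simp
  have h2 : ((Fintype.card (Cycles s) : ℕ) : EReal) = (((Fintype.card (Cycles s) : ℕ) : ℝ) : EReal) := by
    simp
  rw [h1, h2, ← EReal.coe_sub]
  congr 1
  have h3 : ((Fintype.card (Cycles s) : ℕ) : ℝ) * m = n := by exact_mod_cast hs.card_cycles_mul
  rw [← h3]
  field_simp

end SkewPoly

/-! ### Reflection numbers of the cyclic group -/

namespace SkewPoly

/-- A power of a cycle that fixes one point moved by the cycle is the identity, and for `n ≥ 2` the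
rotation moves every point. -/
theorem freeOfOrder_finRotate_pow {n : ℕ} (hn : 2 ≤ n) (j : ℕ) :
    FreeOfOrder (finRotate n ^ j) (orderOf (finRotate n ^ j)) := by
  obtain ⟨n, rfl⟩ := Nat.exists_eq_add_of_le' hn
  refine ⟨pow_orderOf_eq_one _, orderOf_pos _, fun i a h => ?_⟩
  rw [← pow_mul] at h
  rw [orderOf_dvd_iff_pow_eq_one, ← pow_mul, isCycle_finRotate.pow_eq_one_iff]
  have hi : i ∈ (finRotate (n + 2)).support := by simp [support_finRotate]
  exact ⟨i, Equiv.Perm.mem_support.1 hi, h⟩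

theorem orderOf_finRotate_pow_dvd (n : ℕ) [NeZero n] (j : ℕ) : orderOf (finRotate n ^ j) ∣ n :=
  (orderOf_pow_dvd j).trans (orderOf_finRotate n).dvd

variable (k : Type u) [Field k] (n : ℕ)

theorem exists_finRotate_pow_of_mem_W [NeZero n] {g : gradedAut (grading k n)} (hg : g ∈ W k n) :
    ∃ j, permAut k n (finRotate n ^ j) = g := by
  obtain ⟨j, -, hj⟩ := exists_pow_eq_of_forall_mem_zpowers (mem_zpowers_rotation k n)
    (orderOf_rotation k n) ⟨g, hg⟩
  refine ⟨j, ?_⟩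
  rw [map_pow]
  exact congrArg Subtype.val hj

theorem permAut_finRotate_pow_mem_W (j : ℕ) : permAut k n (finRotate n ^ j) ∈ W k n := by
  rw [map_pow]
  exact pow_mem (Subgroup.mem_zpowers _) j

theorem orderOf_ne_one_of_permAut_ne_one {s : Equiv.Perm (Fin n)} (h : permAut k n s ≠ 1) :
    orderOf s ≠ 1 := by
  rw [Ne, orderOf_eq_one_iff]
  rintro rfl
  exact h (map_one _)

theorem reflectionNumber_eq_of_two_pow (hn : 2 ≤ n) (h2 : (2 : k) ≠ 0) {d : ℕ} (hd : n = 2 ^ d) :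
    reflectionNumber (grading k n) (W k n) = n := by
  have : NeZero n := ⟨by omega⟩
  have key : ∀ j, permAut k n (finRotate n ^ j) ≠ 1 →
      autReflectionNumber (grading k n) (permAut k n (finRotate n ^ j)) = n := by
    intro j hj
    refine (freeOfOrder_finRotate_pow hn j).autReflectionNumber_eq_of_even k h2 ?_
    obtain ⟨e, -, he⟩ := (Nat.dvd_prime_pow Nat.prime_two).1
      ((orderOf_finRotate_pow_dvd n j).trans hd.dvd)
    have hne := orderOf_ne_one_of_permAut_ne_one k n hj
    rw [he] at hne ⊢
    refine (Nat.even_pow.2 ⟨even_two, ?_⟩)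
    rintro rfl
    exact hne (pow_zero 2)
  refine le_antisymm ?_ (le_iInf₂ ?_)
  · have hne : permAut k n (finRotate n ^ 1) ≠ 1 := by
      rw [pow_one, Ne, ← map_one (permAut k n), (permAut_injective k n).eq_iff,
        ← orderOf_eq_one_iff, orderOf_finRotate]
      omega
    exact iInf₂_le_of_le _ ⟨permAut_finRotate_pow_mem_W k n 1, hne⟩ (key 1 hne).le
  · rintro g ⟨hg, hne⟩
    obtain ⟨j, rfl⟩ := exists_finRotate_pow_of_mem_W k n hg
    exact (key j hne).ge

theorem reflectionNumber_eq_of_smallest_odd_prime (hn : 2 ≤ n) (hnk : (n : k) ≠ 0)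
    (h2 : (2 : k) ≠ 0) {p : ℕ} (hp : p.Prime) (hodd : Odd p) (hpn : p ∣ n)
    (hmin : ∀ q : ℕ, q.Prime → Odd q → q ∣ n → p ≤ q) :
    reflectionNumber (grading k n) (W k n) = (((n : ℝ) * (1 - 1 / (p : ℝ)) : ℝ) : EReal) := by
  have : NeZero n := ⟨by omega⟩
  have hk : ∀ m, m ∣ n → (m : k) ≠ 0 := by
    rintro m ⟨c, rfl⟩ h
    exact hnk (by simp [h])
  have hp0 : (0 : ℝ) < p := by exact_mod_cast hp.pos
  refine le_antisymm ?_ (le_iInf₂ ?_)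
  · obtain ⟨c, hc⟩ := hpn
    have hc0 : c ≠ 0 := by
      rintro rfl
      omega
    have hord : orderOf (finRotate n ^ c) = p := by
      have hcn : c ∣ orderOf (finRotate n) := by
        rw [orderOf_finRotate, hc]
        exact dvd_mul_left _ _
      rw [orderOf_pow_of_dvd hc0 hcn, orderOf_finRotate]
      exact Nat.div_eq_of_eq_mul_left (Nat.pos_of_ne_zero hc0) hc
    have hne : permAut k n (finRotate n ^ c) ≠ 1 := by
      rw [Ne, ← map_one (permAut k n), (permAut_injective k n).eq_iff, ← orderOf_eq_one_iff, hord]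
      exact hp.ne_one
    have hfree := freeOfOrder_finRotate_pow hn c
    rw [hord] at hfree
    exact iInf₂_le_of_le _ ⟨permAut_finRotate_pow_mem_W k n c, hne⟩
      (hfree.autReflectionNumber_eq_of_odd k (hk p ⟨c, hc⟩) hodd).le
  · rintro g ⟨hg, hne⟩
    obtain ⟨j, rfl⟩ := exists_finRotate_pow_of_mem_W k n hg
    have hfree := freeOfOrder_finRotate_pow hn j
    have hdvd := orderOf_finRotate_pow_dvd n j
    have hne1 := orderOf_ne_one_of_permAut_ne_one k n hne
    rcases Nat.even_or_odd (orderOf (finRotate n ^ j)) with he | ho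
    · rw [hfree.autReflectionNumber_eq_of_even k h2 he]
      have h1 : (n : EReal) = ((n : ℝ) : EReal) := by simp
      rw [h1, EReal.coe_le_coe_iff]
      have : (0 : ℝ) ≤ n * (1 / p) := by positivity
      linarith
    · rw [hfree.autReflectionNumber_eq_of_odd k (hk _ hdvd) ho, EReal.coe_le_coe_iff]
      -- The least prime factor of the odd order is an odd prime dividing `n`, so it is at least
      -- `p`; the reflection number increases with the order.
      have hle : p ≤ orderOf (finRotate n ^ j) :=
        (hmin _ (Nat.minFac_prime hne1) (ho.of_dvd_nat (Nat.minFac_dvd _))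
          ((Nat.minFac_dvd _).trans hdvd)).trans (Nat.minFac_le hfree.2.1)
      have hle' : (p : ℝ) ≤ orderOf (finRotate n ^ j) := by exact_mod_cast hle
      gcongr

end SkewPoly
end

theorem theorem5p7 (k : Type u) [Field k] (n : ℕ) (hn : 2 ≤ n) (hchar : ¬ ringChar k ∣ 2 * n) :
    -- the pertinency for powers of two
    (∀ d : ℕ, n = 2 ^ d → pertinency k (SkewPoly k n) (SkewPoly.W k n) = (n : EReal)) ∧
    -- the reflection number
    ((∀ d : ℕ, n = 2 ^ d →
        reflectionNumber (SkewPoly.grading k n) (SkewPoly.W k n) = (n : EReal)) ∧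
      (∀ p : ℕ, p.Prime → Odd p → p ∣ n → (∀ q : ℕ, q.Prime → Odd q → q ∣ n → p ≤ q) →
        reflectionNumber (SkewPoly.grading k n) (SkewPoly.W k n) =
          (((n : ℝ) * (1 - 1 / (p : ℝ)) : ℝ) : EReal))) ∧
    -- the lower bound for the pertinency
    ((¬ 4 ∣ n → ((Nat.totient n : ℝ) : EReal) ≤ pertinency k (SkewPoly k n) (SkewPoly.W k n)) ∧
      (4 ∣ n →
        (((Nat.totient n : ℝ) / 2 : ℝ) : EReal) ≤
          pertinency k (SkewPoly k n) (SkewPoly.W k n))) ∧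
    -- prime powers
    (∀ p d : ℕ, p.Prime → n = p ^ d →
      reflectionNumber (SkewPoly.grading k n) (SkewPoly.W k n) ≤
          pertinency k (SkewPoly k n) (SkewPoly.W k n) ∧
        (p = 2 → reflectionNumber (SkewPoly.grading k n) (SkewPoly.W k n) = (n : EReal)) ∧
        (2 < p → reflectionNumber (SkewPoly.grading k n) (SkewPoly.W k n) =
          (((n : ℝ) * (1 - 1 / (p : ℝ)) : ℝ) : EReal))) := by
  have hcast : ((2 * n : ℕ) : k) ≠ 0 := fun h => hchar ((ringChar.spec k _).1 h)
  have h2 : (2 : k) ≠ 0 := fun h => hcast (by simp [h])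
  have hnk : (n : k) ≠ 0 := fun h => hcast (by simp [h])
  have : NeZero n := ⟨by omega⟩
  have htot := SkewPoly.totient_le_pertinency k n hnk
  have hodd : ∀ p d : ℕ, p.Prime → n = p ^ d → 2 < p →
      reflectionNumber (SkewPoly.grading k n) (SkewPoly.W k n) =
        (((n : ℝ) * (1 - 1 / (p : ℝ)) : ℝ) : EReal) := by
    intro p d hp hd hp2
    have hd0 : d ≠ 0 := by
      rintro rfl
      rw [pow_zero] at hd
      omega
    refine SkewPoly.reflectionNumber_eq_of_smallest_odd_prime k n hn hnk h2 hp
      (hp.odd_of_ne_two hp2.ne') (hd ▸ dvd_pow_self p hd0) fun q hq _ hqn => ?_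
    exact ((Nat.prime_dvd_prime_iff_eq hq hp).1 (hq.dvd_of_dvd_pow (hd ▸ hqn))).ge
  refine ⟨fun d hd => SkewPoly.pertinency_eq_of_two_pow k n hn hnk h2 hd,
    ⟨fun d hd => SkewPoly.reflectionNumber_eq_of_two_pow k n hn h2 hd, fun p hp ho hpn hmin =>
      SkewPoly.reflectionNumber_eq_of_smallest_odd_prime k n hn hnk h2 hp ho hpn hmin⟩,
    ⟨fun _ => htot, fun _ => le_trans ?_ htot⟩, fun p d hp hd => ⟨?_, ?_, hodd p d hp hd⟩⟩
  -- The bound `φ(n)` does not depend on whether `4` divides `n`, so the weaker bound `φ(n) / 2`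
  -- follows from it.
  · rw [EReal.coe_le_coe_iff]
    exact half_le_self (Nat.cast_nonneg _)
  · rcases hp.two_le.eq_or_lt' with rfl | hp2
    · rw [SkewPoly.reflectionNumber_eq_of_two_pow k n hn h2 hd,
        SkewPoly.pertinency_eq_of_two_pow k n hn hnk h2 hd]
    · rw [hodd p d hp hd hp2]
      refine le_trans (le_of_eq ?_) htot
      obtain ⟨e, rfl⟩ : ∃ e, d = e + 1 := Nat.exists_eq_succ_of_ne_zero (by
        rintro rfl
        rw [pow_zero] at hd
        omega)
      have hp0 : (p : ℝ) ≠ 0 := by exact_mod_cast hp.ne_zero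
      -- For a power of an odd prime the reflection number is `φ(n)` itself, so the totient bound
      -- suffices.
      have hval : (n : ℝ) * (1 - 1 / p) = n.totient := by
        rw [hd, Nat.totient_prime_pow_succ hp]
        push_cast [Nat.cast_sub hp.one_le]
        field_simp
        ring
      rw [hval]
  · rintro rfl
    exact SkewPoly.reflectionNumber_eq_of_two_pow k n hn h2 hd
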